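/- **Large-rank asymptotics for symmetric community detection.** For an integer $r\ge 2$ and $x\ge 0$ let $$\mathcal M_r(x)=\frac1{r-1}\left[r\,\mathbb E\left(\frac{e^{x/r+u_1\sqrt{x/r}}}{e^{x/r+u_1\sqrt{x/r}}+\sum_{i=2}^r e^{u_i\sqrt{x/r}}}\right)-1\right],$$ with $u_1,\dots,u_r$ independent standard Gaussians. The state evolution of symmetric community detection with $r$ groups at effective noise $\Delta>0$ is $b^{t+1}=\mathcal M_r(b^t/\Delta)$; the scalar $b\in[0,1]$ encodes the order parameter $M(b)=\frac br I_r+\frac{1-b}{r^2}J_r$, where $J_r$ is the all-ones matrix, and $b=0$ is always a fixed point (the uniform one). The replica free energy is $$\phi(b,\Delta)=\mathbb E_{x_0,W}\left[\log Z\left(\tfrac{M(b)}\Delta,\ \tfrac{M(b)}\Delta x_0+\sqrt{\tfrac{M(b)}\Delta}\,W\right)\right]-\frac{\mathrm{Tr}\,(M(b)M(b)^{\top})}{4\Delta},\qquad Z(A,B)=\frac1r\sum_{s=1}^r e^{B^\top e_s-\frac12 e_s^\top A e_s},$$ where $x_0$ is uniform on the canonical basis $\{e_1,\dots,e_r\}$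 of $\mathbb R^r$ and $W$ is an independent standard Gaussian vector in $\mathbb R^r$. The informative fixed point $b_{\rm inf}(\Delta)$ is the limit of the state evolution started at $b^0=1$, and the uninformative fixed point $b_{\rm un}(\Delta)$ is its common limit from $b^0=\varepsilon$ for all sufficiently small $\varepsilon>0$. Define * $\Delta_c(r)$: the infimum of the $\Delta>0$ for which the uniform fixed point is stable, i.e. the state evolution started from every sufficiently small $b^0\ge0$ converges to $0$; * $\Delta_{\rm Dyn}(r)$: the greatest $\Delta>0$ for which the state evolution has a fixed point $b>0$; * $\Delta_{\rm IT}(r)$: the greatest $\Delta>0$ for which $b_{\rm un}(\Delta)$ and $b_{\rm inf}(\Delta)$ both exist, are different, and satisfy $\phi(b_{\rm un}(\Delta),\Delta)=\phi(b_{\rm inf}(\Delta),\Delta)$. Then, with $\ln$ the natural logarithm: 1. for every fixed $\beta\ge0$ with $\beta\ne2$, $\ \mathcal M_r(\beta r\ln r)\to \mathbf 1(\beta>2)$ as $r\to\infty$; 2. for all sufficiently large $r$ the maximum defining $\Delta_{\rm Dyn}(r)$ exists, and $\Delta_{\rm Dyn}(r)=\dfrac{1+o(1)}{2r\ln r}$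 as $r\to\infty$; 3. for all sufficiently large $r$ the maximum defining $\Delta_{\rm IT}(r)$ exists, and $\Delta_{\rm IT}(r)=\dfrac{1+o(1)}{4r\ln r}$ as $r\to\infty$; 4. $\Delta_c(r)=1/r^2$ for every $r\ge2$. -/

import Mathlib

open MeasureTheory ProbabilityTheory Filter Topology Asymptotics

noncomputable section

namespace CommunityDetection

/-- The state evolution function `𝓜_r` of symmetric community detection with `r` groups:
`𝓜_r(x) = (r 𝔼[e^{x/r + u₁√(x/r)} / (e^{x/r + u₁√(x/r)} + ∑_{i=2}^r e^{uᵢ√(x/r)})] - 1) / (r - 1)`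
with `u₁, …, u_r` independent standard Gaussians. The pair `(v, w)` below is
`(u₁, (u₂, …, u_r))`. -/
def stateFun (r : ℕ) (x : ℝ) : ℝ :=
  (1 / ((r : ℝ) - 1)) *
    ((r : ℝ) *
      (∫ u : ℝ × (Fin (r - 1) → ℝ),
        Real.exp (x / r + u.1 * √(x / r)) /
          (Real.exp (x / r + u.1 * √(x / r)) + ∑ i, Real.exp (u.2 i * √(x / r)))
        ∂((gaussianReal 0 1).prod (Measure.pi fun _ : Fin (r - 1) => gaussianReal 0 1))) - 1)

/-- One step of state evolution for the scalar order parameter: `b ↦ 𝓜_r(b / Δ)`. -/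
def stateEvolution (r : ℕ) (Δ b : ℝ) : ℝ := stateFun r (b / Δ)

/-- The order parameter matrix `M = b I_r / r + (1 - b) J_r / r²`. -/
def orderParam (r : ℕ) (b : ℝ) : Matrix (Fin r) (Fin r) ℝ :=
  (b / (r : ℝ)) • (1 : Matrix (Fin r) (Fin r) ℝ) +
    ((1 - b) / (r : ℝ) ^ 2) • Matrix.of fun _ _ => (1 : ℝ)

/-- The normalisation `Z_x(A, B) = ∫ P_X(dx) exp(Bᵀ x - xᵀ A x / 2)` for the prior
`P_X = (1/r) ∑ₛ δ(e_s)` that is uniform on the canonical basis vectors of `ℝ^r`. -/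
def partitionFun (r : ℕ) (A : Matrix (Fin r) (Fin r) ℝ) (B : Fin r → ℝ) : ℝ :=
  (1 / (r : ℝ)) * ∑ s : Fin r,
    Real.exp (B ⬝ᵥ Pi.single s 1 -
      (Pi.single s 1 : Fin r → ℝ) ⬝ᵥ (A.mulVec (Pi.single s 1)) / 2)

/-- The Bayes-optimal replica free energy
`φ(M) = 𝔼_{x₀, W}[log Z_x(M/Δ, (M/Δ) x₀ + √(M/Δ) W)] - Tr(M Mᵀ) / (4 Δ)`,
where `x₀` is drawn from the prior and `W` is a standard Gaussian vector in `ℝ^r`; given `x₀`,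
the vector `B = (M/Δ) x₀ + √(M/Δ) W` is Gaussian with mean `(M/Δ) x₀` and covariance `M/Δ`. -/
def replicaFreeEnergy (r : ℕ) (Δ : ℝ) (M : Matrix (Fin r) (Fin r) ℝ) : ℝ :=
  (1 / (r : ℝ)) * (∑ t : Fin r,
    ∫ B : EuclideanSpace ℝ (Fin r), Real.log (partitionFun r (Δ⁻¹ • M) B.ofLp)
      ∂(multivariateGaussian
          (WithLp.toLp 2 ((Δ⁻¹ • M).mulVec (Pi.single t 1))) (Δ⁻¹ • M))) -
    (M * M.transpose).trace / (4 * Δ)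

/-- The free energy as a function of the scalar order parameter. -/
def freeEnergy (r : ℕ) (Δ b : ℝ) : ℝ := replicaFreeEnergy r Δ (orderParam r b)

/-- `b` is the limit of state evolution started from the informative initialisation `b⁰ = 1`
(that is, `M⁰ = ⟨x xᵀ⟩ = I_r / r`). -/
def IsInformative (r : ℕ) (Δ b : ℝ) : Prop :=
  Tendsto (fun t : ℕ => (stateEvolution r Δ)^[t] 1) atTop (𝓝 b)

/-- `b` is the limit of state evolution started from the uninformative initialisation `b⁰ = ε`,
for every sufficiently small `ε > 0`. -/
def IsUninformative (r : ℕ) (Δ b : ℝ) : Prop :=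
  ∀ᶠ ε in 𝓝[>] (0 : ℝ), Tendsto (fun t : ℕ => (stateEvolution r Δ)^[t] ε) atTop (𝓝 b)

/-- The uniform fixed point `b = 0` is stable: state evolution started close enough to it
(among `b ≥ 0`) converges to it. -/
def UniformStable (r : ℕ) (Δ : ℝ) : Prop :=
  ∀ᶠ b in 𝓝[≥] (0 : ℝ), Tendsto (fun t : ℕ => (stateEvolution r Δ)^[t] b) atTop (𝓝 0)

/-- The spectral transition: the threshold in `Δ` above which the uniform fixed point is stable. -/
def deltaC (r : ℕ) : ℝ := sInf {Δ : ℝ | 0 < Δ ∧ UniformStable r Δ}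

/-- The noise levels at which state evolution has a fixed point other than the uniform one. -/
def dynSet (r : ℕ) : Set ℝ :=
  {Δ : ℝ | 0 < Δ ∧ ∃ b : ℝ, 0 < b ∧ stateEvolution r Δ b = b}

/-- The dynamic spinodal transition: the greatest `Δ` with a fixed point `b > 0`. -/
def deltaDyn (r : ℕ) : ℝ := sSup (dynSet r)

/-- The noise levels at which the uninformative and the informative fixed points both exist, are
different, and have the same replica free energy. -/
def itSet (r : ℕ) : Set ℝ :=
  {Δ : ℝ | 0 < Δ ∧ ∃ b₀ b₁ : ℝ, IsUninformative r Δ b₀ ∧ IsInformative r Δ b₁ ∧ b₀ ≠ b₁ ∧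
    freeEnergy r Δ b₀ = freeEnergy r Δ b₁}

/-- The information theoretic transition: the greatest `Δ` at which two different fixed points
have the same replica free energy. -/
def deltaIT (r : ℕ) : ℝ := sSup (itSet r)

end CommunityDetection

end

/-!
Write `q = x / r` and `n = r - 1`. In the Gaussian channel with planted group `0` and noise `w`, the
posterior weight of group `i + 1` relative to that of the true group is
`exp(√q (w_{i+1} - w_0) - q)`. Let `R` be the sum of these ratios. Everything in the statement is
expressed through the overlap `f(q) = 𝔼 (1 + R)⁻¹` (`overlap`), with
`𝓜_r(x) = (r f(q) - 1) / (r - 1)` (`stateFun_eq`), and the logarithmic loss `K(q) = 𝔼 log (1 + R)` (`logLoss`), with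
`φ(b) - φ(0) = q/2 - log r + K(q) - q/(2r) - b q (r - 1)/(4r)` (`freeEnergy_sub_freeEnergy_zero`).

**Regularity.** A Gaussian of variance `q + h` is the sum of independent ones of variances `q` and
`h`, so raising `q` to `q + h` multiplies each ratio by an independent factor of mean one
(`integral_comp_ratioSum_add`). The first-order terms in the expansions of `(1 + R)⁻¹` and
`log (1 + R)` then average to zero and the second-order terms are controlled by a variance. This
gives monotonicity and continuity of `f`, continuity of `K`, and
`f(q + h) - f(q) ≤ (exp(2h) - 1) (1 - f(q))` (`overlap_add_le`).

**Spectral threshold.** The second-order expansion at `q = 0` gives `𝓜_r(x) / x → 1 / r²`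
(`tendsto_stateFun_div`), whence `Δ_c = 1 / r²`.

**Large rank.** For `β > 2`, `1 - f(β log r)` is bounded by a negative power of `r`
(`one_sub_overlap_le`). For `β < 2` the largest of the wrong groups, at height about `√(2 log r)`,
outweighs the true one (`overlap_le_pow_add_exp`). So `𝓜_r(β r log r)` jumps from `0` to `1` at
`β = 2`. Together with `𝓜_r(x) ≤ (exp(2x/r) - 1) / r`, which handles small `x`, this excludes fixed
points `x < β r log r` with `β < 2` when `Δ` is of order `1 / (r log r)`
(`eventually_le_of_le_stateFun`). Since the noises having a fixed point `b > 0` are the positive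
values of `𝓜_r(x) / x`, the greatest one is `~ 1 / (2 r log r)`.

**Information-theoretic threshold.** Elementary bounds give
`q/2 - log r + K(q) = (q/2 - log r)⁺ + o(log r)`, so with `x = y r log r` and `y` bounded the free
energy gap is `log r` times `(y/2 - 1)⁺ - b y / 4 + o(1)`. By `overlap_add_le`, `𝓜_r(x) / x` is
strictly decreasing on `x ≥ 3 r log r`, so each such `x` encodes the informative fixed point at
noise `Δ = 𝓜_r(x) / x`, while `b_un = 0` because `Δ > 1 / r²`. The gap is continuous in `x`, changes
sign between `y = 3` and `y = 5`, and its zeros there have `y → 4`. Positive fixed points at noise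
at least `15 / (64 r log r)` with zero gap all lie in this range, so the noises of this order at
which the two free energies agree are the values of the continuous function `𝓜_r(x) / x` on a
nonempty compact set, and its maximum is `~ 1 / (4 r log r)`.
-/

noncomputable section

namespace CommunityDetection

/-! ### Gaussian moments and tilts -/

section

/-- The standard Gaussian measure on `ι → ℝ`, as a product of one-dimensional laws. -/
abbrev stdNormal (ι : Type*) [Fintype ι] : Measure (ι → ℝ) :=
  Measure.pi fun _ => gaussianReal 0 1

variable {ι : Type*} [Fintype ι]

lemma integrable_exp_sum (a : ι → ℝ) :
    Integrable (fun w : ι → ℝ => Real.exp (∑ i, a i * w i)) (stdNormal ι) := by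
  simp_rw [Real.exp_sum]
  exact Integrable.fintype_prod (f := fun i (x : ℝ) => Real.exp (a i * x))
    fun i => integrable_exp_mul_gaussianReal (a i)

lemma integral_exp_mul_gaussianReal (a : ℝ) :
    ∫ x, Real.exp (a * x) ∂(gaussianReal 0 1) = Real.exp (a ^ 2 / 2) := by
  have := congrFun (mgf_fun_id_gaussianReal (μ := 0) (v := 1)) a
  simpa [mgf] using this

lemma integral_exp_sum (a : ι → ℝ) :
    ∫ w, Real.exp (∑ i, a i * w i) ∂(stdNormal ι) = Real.exp ((∑ i, a i ^ 2) / 2) := by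
  simp_rw [Real.exp_sum]
  rw [integral_fintype_prod_eq_prod (fun i (x : ℝ) => Real.exp (a i * x))]
  simp_rw [integral_exp_mul_gaussianReal, ← Real.exp_sum, Finset.sum_div]

lemma gaussianReal_map_sqrt_add {q h : ℝ} (hq : 0 ≤ q) (hh : 0 ≤ h) :
    ((gaussianReal 0 1).prod (gaussianReal 0 1)).map (fun p : ℝ × ℝ => √q * p.1 + √h * p.2) =
      (gaussianReal 0 1).map (fun x => √(q + h) * x) := by
  have e : (fun p : ℝ × ℝ => √q * p.1 + √h * p.2) =
      (fun p : ℝ × ℝ => p.1 + p.2) ∘ (Prod.map (fun x => √q * x) (fun x => √h * x)) := rfl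
  rw [e, ← Measure.map_map (by fun_prop) (by fun_prop),
    ← Measure.map_prod_map _ _ (by fun_prop) (by fun_prop),
    gaussianReal_map_const_mul, gaussianReal_map_const_mul, gaussianReal_map_const_mul]
  have := gaussianReal_conv_gaussianReal (m₁ := √q * 0) (m₂ := √h * 0)
    (v₁ := ⟨√q ^ 2, sq_nonneg _⟩ * 1) (v₂ := ⟨√h ^ 2, sq_nonneg _⟩ * 1)
  rw [Measure.conv] at this
  refine this.trans ?_
  congr 1
  · simp
  · ext
    change √q ^ 2 * 1 + √h ^ 2 * 1 = √(q + h) ^ 2 * 1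
    rw [Real.sq_sqrt hq, Real.sq_sqrt hh, Real.sq_sqrt (add_nonneg hq hh)]
    ring

/-- Independent Gaussian increments: `√q W + √h W'` has the law of `√(q + h) W`. -/
lemma stdNormal_map_sqrt_add {q h : ℝ} (hq : 0 ≤ q) (hh : 0 ≤ h) :
    ((stdNormal ι).prod (stdNormal ι)).map (fun p i => √q * p.1 i + √h * p.2 i) =
      (stdNormal ι).map (fun w i => √(q + h) * w i) := by
  rw [← (measurePreserving_arrowProdEquivProdArrow ℝ ℝ ι (fun _ => gaussianReal 0 1)
    (fun _ => gaussianReal 0 1)).map_eq,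
    Measure.map_map (by fun_prop) (MeasurableEquiv.measurable _)]
  have e : ((fun (p : (ι → ℝ) × (ι → ℝ)) i => √q * p.1 i + √h * p.2 i) ∘
      (MeasurableEquiv.arrowProdEquivProdArrow ℝ ℝ ι)) =
      fun (x : ι → ℝ × ℝ) i => (fun p : ℝ × ℝ => √q * p.1 + √h * p.2) (x i) := rfl
  rw [e, Measure.pi_map_pi (f := fun _ (p : ℝ × ℝ) => √q * p.1 + √h * p.2)
      (fun _ => Measurable.aemeasurable (by fun_prop)),
    Measure.pi_map_pi (f := fun _ (x : ℝ) => √(q + h) * x)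
      (fun _ => Measurable.aemeasurable (by fun_prop))]
  simp_rw [gaussianReal_map_sqrt_add hq hh]

lemma integral_stdNormal_sqrt_add {q h : ℝ} (hq : 0 ≤ q) (hh : 0 ≤ h) {g : (ι → ℝ) → ℝ}
    (hg : Measurable g) :
    ∫ w, g (fun i => √(q + h) * w i) ∂(stdNormal ι) =
      ∫ p, g (fun i => √q * p.1 i + √h * p.2 i) ∂((stdNormal ι).prod (stdNormal ι)) := by
  rw [← integral_map (φ := fun (w : ι → ℝ) i => √(q + h) * w i)
      (Measurable.aemeasurable (by fun_prop))
      hg.aestronglyMeasurable, ← stdNormal_map_sqrt_add hq hh,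
    integral_map (Measurable.aemeasurable (by fun_prop)) hg.aestronglyMeasurable]

lemma integrable_stdNormal_sqrt_add {q h : ℝ} (hq : 0 ≤ q) (hh : 0 ≤ h) {g : (ι → ℝ) → ℝ}
    (hg : Measurable g)
    (hi : Integrable (fun w : ι → ℝ => g (fun i => √(q + h) * w i)) (stdNormal ι)) :
    Integrable (fun p : (ι → ℝ) × (ι → ℝ) => g (fun i => √q * p.1 i + √h * p.2 i))
      ((stdNormal ι).prod (stdNormal ι)) := by
  have h1 : Integrable g ((stdNormal ι).map fun w i => √(q + h) * w i) :=
    (integrable_map_measure hg.aestronglyMeasurable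
      (Measurable.aemeasurable (by fun_prop))).2 hi
  rw [← stdNormal_map_sqrt_add hq hh] at h1
  exact (integrable_map_measure hg.aestronglyMeasurable
      (Measurable.aemeasurable (by fun_prop))).1 h1

/-- `tilt n h c v = ∑ᵢ cᵢ exp(√h (vᵢ - v₀) - h)`. For a standard Gaussian `v` this has mean
`∑ᵢ cᵢ`; with `c = 1` and `h = x / r` it is the ratio of the posterior weight of the `n = r - 1`
wrong groups to that of the true group. -/
def tilt (n : ℕ) (h : ℝ) (c : Fin n → ℝ) (v : Fin (n + 1) → ℝ) : ℝ :=
  ∑ i, c i * Real.exp (√h * (v i.succ - v 0) - h)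

variable {n : ℕ}

@[fun_prop]
lemma measurable_tilt (h : ℝ) (c : Fin n → ℝ) : Measurable (tilt n h c) := by
  unfold tilt; fun_prop

lemma tilt_nonneg {c : Fin n → ℝ} (hc : ∀ i, 0 ≤ c i) (h : ℝ) (v : Fin (n + 1) → ℝ) :
    0 ≤ tilt n h c v :=
  Finset.sum_nonneg fun i _ => mul_nonneg (hc i) (Real.exp_pos _).le

lemma integral_exp_cons (a : ℝ) (b : Fin n → ℝ) :
    Integrable (fun w : Fin (n + 1) → ℝ => Real.exp (a * w 0 + ∑ i, b i * w i.succ))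
      (stdNormal (Fin (n + 1))) ∧
    ∫ w, Real.exp (a * w 0 + ∑ i, b i * w i.succ) ∂(stdNormal (Fin (n + 1))) =
      Real.exp ((a ^ 2 + ∑ i, b i ^ 2) / 2) := by
  have h1 := integrable_exp_sum (Fin.cons a b : Fin (n + 1) → ℝ)
  have h2 := integral_exp_sum (Fin.cons a b : Fin (n + 1) → ℝ)
  simp only [Fin.sum_univ_succ, Fin.cons_zero, Fin.cons_succ] at h1 h2
  exact ⟨h1, h2⟩

lemma integral_exp_pair (a b : ℝ) (i : Fin n) :
    Integrable (fun w : Fin (n + 1) → ℝ => Real.exp (a * w 0 + b * w i.succ))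
      (stdNormal (Fin (n + 1))) ∧
    ∫ w, Real.exp (a * w 0 + b * w i.succ) ∂(stdNormal (Fin (n + 1))) =
      Real.exp ((a ^ 2 + b ^ 2) / 2) := by
  have := integral_exp_cons a (Pi.single i b)
  simpa [Pi.single_apply, ite_pow] using this

/-- The moments of `exp(√h (vᵢ - v₀) - h)`. -/
lemma integral_exp_sub (h : ℝ) (hh : 0 ≤ h) (k : ℝ) (i : Fin n) :
    Integrable (fun v : Fin (n + 1) → ℝ => Real.exp (k * (√h * (v i.succ - v 0) - h)))
      (stdNormal (Fin (n + 1))) ∧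
    ∫ v, Real.exp (k * (√h * (v i.succ - v 0) - h)) ∂(stdNormal (Fin (n + 1))) =
      Real.exp (k * (k - 1) * h) := by
  have e : (fun v : Fin (n + 1) → ℝ => Real.exp (k * (√h * (v i.succ - v 0) - h))) =
      fun v => Real.exp (-(k * h)) * Real.exp (-(k * √h) * v 0 + k * √h * v i.succ) := by
    ext v
    rw [← Real.exp_add]
    ring_nf
  have ⟨h1, h2⟩ := integral_exp_pair (-(k * √h)) (k * √h) i
  rw [e]
  refine ⟨h1.const_mul _, ?_⟩
  rw [integral_const_mul, h2, ← Real.exp_add, neg_sq, mul_pow, Real.sq_sqrt hh]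
  ring_nf

lemma integral_tilt {h : ℝ} (hh : 0 ≤ h) (c : Fin n → ℝ) :
    Integrable (tilt n h c) (stdNormal (Fin (n + 1))) ∧
    ∫ v, tilt n h c v ∂(stdNormal (Fin (n + 1))) = ∑ i, c i := by
  have H := fun i : Fin n => integral_exp_sub h hh 1 i
  simp only [one_mul, sub_self, mul_zero, zero_mul, Real.exp_zero] at H
  have e : tilt n h c = fun v => ∑ i, c i * Real.exp (√h * (v i.succ - v 0) - h) := rfl
  rw [e]
  refine ⟨integrable_finsetSum _ fun i _ => (H i).1.const_mul _, ?_⟩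
  rw [integral_finsetSum _ fun i _ => (H i).1.const_mul _]
  simp_rw [integral_const_mul, (H _).2, mul_one]

/-- A second moment bound, from the Cauchy-Schwarz inequality with the weights `cᵢ`. -/
lemma integral_tilt_sub_sq {h : ℝ} (hh : 0 ≤ h) {c : Fin n → ℝ} (hc : ∀ i, 0 ≤ c i) :
    Integrable (fun v => (tilt n h c v - ∑ i, c i) ^ 2) (stdNormal (Fin (n + 1))) ∧
    ∫ v, (tilt n h c v - ∑ i, c i) ^ 2 ∂(stdNormal (Fin (n + 1))) ≤
      (∑ i, c i) ^ 2 * (Real.exp (2 * h) - 1) := by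
  have H1 := fun i : Fin n => integral_exp_sub h hh 1 i
  have H2 := fun i : Fin n => integral_exp_sub h hh 2 i
  have hbi : ∀ i : Fin n, Integrable (fun v : Fin (n + 1) → ℝ =>
      (Real.exp (√h * (v i.succ - v 0) - h) - 1) ^ 2) (stdNormal (Fin (n + 1))) ∧
      ∫ v, (Real.exp (√h * (v i.succ - v 0) - h) - 1) ^ 2 ∂(stdNormal (Fin (n + 1))) =
        Real.exp (2 * h) - 1 := by
    intro i
    have e : (fun v : Fin (n + 1) → ℝ => (Real.exp (√h * (v i.succ - v 0) - h) - 1) ^ 2) =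
        fun v => (Real.exp (2 * (√h * (v i.succ - v 0) - h)) -
          2 * Real.exp (1 * (√h * (v i.succ - v 0) - h))) + 1 := by
      ext v
      rw [one_mul, two_mul, Real.exp_add]; ring
    rw [e]
    have hs : Integrable (fun v : Fin (n + 1) → ℝ => Real.exp (2 * (√h * (v i.succ - v 0) - h)) -
        2 * Real.exp (1 * (√h * (v i.succ - v 0) - h))) (stdNormal (Fin (n + 1))) :=
      (H2 i).1.sub ((H1 i).1.const_mul 2)
    refine ⟨hs.add (integrable_const _), ?_⟩
    rw [integral_add hs (integrable_const _),
      integral_sub (H2 i).1 ((H1 i).1.const_mul 2), integral_const_mul, (H2 i).2, (H1 i).2]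
    norm_num
    ring
  have hle : ∀ v, (tilt n h c v - ∑ i, c i) ^ 2 ≤
      (∑ i, c i) * ∑ i, c i * (Real.exp (√h * (v i.succ - v 0) - h) - 1) ^ 2 := by
    intro v
    have e : tilt n h c v - ∑ i, c i =
        ∑ i, c i * (Real.exp (√h * (v i.succ - v 0) - h) - 1) := by
      simp [tilt, mul_sub, Finset.sum_sub_distrib]
    rw [e]
    refine Finset.sum_sq_le_sum_mul_sum_of_sq_le_mul _ (fun i _ => hc i)
      (fun i _ => mul_nonneg (hc i) (sq_nonneg _)) fun i _ => le_of_eq (by ring)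
  have hint : Integrable (fun v : Fin (n + 1) → ℝ =>
      (∑ i, c i) * ∑ i, c i * (Real.exp (√h * (v i.succ - v 0) - h) - 1) ^ 2)
      (stdNormal (Fin (n + 1))) :=
    (integrable_finsetSum _ fun i _ => (hbi i).1.const_mul _).const_mul _
  have hint' : Integrable (fun v => (tilt n h c v - ∑ i, c i) ^ 2) (stdNormal (Fin (n + 1))) :=
    hint.mono' (by fun_prop) (ae_of_all _ fun v => by
      rw [Real.norm_of_nonneg (sq_nonneg _)]; exact hle v)
  refine ⟨hint', (integral_mono hint' hint hle).trans_eq ?_⟩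
  rw [integral_const_mul, integral_finsetSum _ fun i _ => (hbi i).1.const_mul _]
  simp_rw [integral_const_mul, (hbi _).2, ← Finset.sum_mul]
  ring

end

/-! ### The posterior weight of the true group -/

section

variable {n : ℕ}

/-- The ratio of the posterior weight of the wrong group `i + 1` to that of the true group `0`, at
signal-to-noise ratio `q`. -/
def weight (n : ℕ) (q : ℝ) (w : Fin (n + 1) → ℝ) (i : Fin n) : ℝ :=
  Real.exp (√q * (w i.succ - w 0) - q)

/-- The sum of the weight ratios of all wrong groups. -/
def ratioSum (n : ℕ) (q : ℝ) (w : Fin (n + 1) → ℝ) : ℝ := ∑ i, weight n q w i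

lemma weight_pos (q : ℝ) (w : Fin (n + 1) → ℝ) (i : Fin n) : 0 < weight n q w i :=
  Real.exp_pos _

lemma ratioSum_eq_tilt (q : ℝ) : ratioSum n q = tilt n q 1 := by
  ext w; simp [ratioSum, tilt, weight]

lemma ratioSum_nonneg (q : ℝ) (w : Fin (n + 1) → ℝ) : 0 ≤ ratioSum n q w :=
  Finset.sum_nonneg fun i _ => (weight_pos q w i).le

@[fun_prop]
lemma measurable_ratioSum (q : ℝ) : Measurable (ratioSum n q) := by
  rw [ratioSum_eq_tilt]; fun_prop

lemma integral_ratioSum {q : ℝ} (hq : 0 ≤ q) :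
    Integrable (ratioSum n q) (stdNormal (Fin (n + 1))) ∧
    ∫ w, ratioSum n q w ∂(stdNormal (Fin (n + 1))) = n := by
  rw [ratioSum_eq_tilt]
  simpa using integral_tilt hq (1 : Fin n → ℝ)

/-- Decomposition of a Gaussian channel into two independent steps: conditionally on the weight
ratios at signal-to-noise ratio `q`, those at `q + h` are obtained by tilting. -/
lemma integral_comp_ratioSum_add {q h : ℝ} (hq : 0 ≤ q) (hh : 0 ≤ h) {g : ℝ → ℝ}
    (hg : Measurable g)
    (hi : Integrable (fun w => g (ratioSum n (q + h) w)) (stdNormal (Fin (n + 1)))) :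
    Integrable (fun w => ∫ v, g (tilt n h (weight n q w) v) ∂(stdNormal (Fin (n + 1))))
      (stdNormal (Fin (n + 1))) ∧
    ∫ w, g (ratioSum n (q + h) w) ∂(stdNormal (Fin (n + 1))) =
      ∫ w, ∫ v, g (tilt n h (weight n q w) v) ∂(stdNormal (Fin (n + 1)))
        ∂(stdNormal (Fin (n + 1))) := by
  set G : (Fin (n + 1) → ℝ) → ℝ := fun z => g (∑ i : Fin n, Real.exp (z i.succ - z 0 - (q + h)))
    with hG
  have hGm : Measurable G := by fun_prop
  have e1 : (fun w => g (ratioSum n (q + h) w)) =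
      fun w : Fin (n + 1) → ℝ => G (fun i => √(q + h) * w i) := by
    ext w; simp [hG, ratioSum, weight, mul_sub]
  have e2 : (fun p : (Fin (n + 1) → ℝ) × (Fin (n + 1) → ℝ) =>
      G (fun i => √q * p.1 i + √h * p.2 i)) = fun p => g (tilt n h (weight n q p.1) p.2) := by
    ext p
    simp only [hG, tilt, weight, ← Real.exp_add]
    congr 1
    refine Finset.sum_congr rfl fun i _ => ?_
    ring_nf
  have hi' := hi
  rw [e1] at hi' ⊢
  have h2 := integrable_stdNormal_sqrt_add hq hh hGm hi'
  rw [integral_stdNormal_sqrt_add hq hh hGm]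
  rw [e2] at h2 ⊢
  exact ⟨h2.integral_prod_left, integral_prod _ h2⟩

/-- The expected posterior weight of the true group at signal-to-noise ratio `q`. -/
def overlap (n : ℕ) (q : ℝ) : ℝ := ∫ w, (1 + ratioSum n q w)⁻¹ ∂(stdNormal (Fin (n + 1)))

lemma integrable_inv_one_add {Ω : Type*} [MeasurableSpace Ω] {μ : Measure Ω} [IsFiniteMeasure μ]
    {g : Ω → ℝ} (hg : Measurable g) (h0 : ∀ w, 0 ≤ g w) : Integrable (fun w => (1 + g w)⁻¹) μ :=
  (integrable_const (1 : ℝ)).mono' (by fun_prop) (ae_of_all _ fun w => by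
    have := h0 w
    rw [Real.norm_of_nonneg (by positivity)]
    exact inv_le_one_of_one_le₀ (by linarith))

lemma overlap_nonneg (n : ℕ) (q : ℝ) : 0 ≤ overlap n q :=
  integral_nonneg fun w => inv_nonneg.2 (by have := ratioSum_nonneg q w; linarith)

lemma overlap_le_one (n : ℕ) (q : ℝ) : overlap n q ≤ 1 := by
  refine (integral_mono (integrable_inv_one_add (measurable_ratioSum q) (ratioSum_nonneg q))
    (integrable_const 1) fun w => ?_).trans_eq (by simp)
  exact inv_le_one_of_one_le₀ (by have := ratioSum_nonneg q w; linarith)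

lemma overlap_zero (n : ℕ) : overlap n 0 = 1 / ((n : ℝ) + 1) := by
  simp [overlap, ratioSum, weight, add_comm]

/-- The tangent line to `y ↦ 1 / (1 + y)`, with its remainder term. -/
lemma inv_one_add_eq {R y : ℝ} (hR : 0 ≤ R) (hy : 0 ≤ y) :
    (1 + y)⁻¹ = (1 + R)⁻¹ - ((1 + R) ^ 2)⁻¹ * (y - R) +
      (y - R) ^ 2 * (((1 + R) ^ 2)⁻¹ * (1 + y)⁻¹) := by
  have h1 : 1 + R ≠ 0 := by linarith
  have h2 : 1 + y ≠ 0 := by linarith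
  field_simp
  ring

lemma integral_tangent {h : ℝ} (hh : 0 ≤ h) (c : Fin n → ℝ) (a b : ℝ) :
    Integrable (fun v => a - b * (tilt n h c v - ∑ i, c i)) (stdNormal (Fin (n + 1))) ∧
    ∫ v, (a - b * (tilt n h c v - ∑ i, c i)) ∂(stdNormal (Fin (n + 1))) = a := by
  have ⟨h1, h2⟩ := integral_tilt hh c
  have h3 : Integrable (fun v => tilt n h c v - ∑ i, c i) (stdNormal (Fin (n + 1))) :=
    h1.sub (integrable_const _)
  refine ⟨(integrable_const a).sub (h3.const_mul b), ?_⟩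
  rw [integral_sub (integrable_const a) (h3.const_mul b), integral_const_mul,
    integral_sub h1 (integrable_const _), h2]
  simp

/-- Jensen's inequality for `y ↦ 1 / (1 + y)` along a tilt. -/
lemma inv_one_add_le_integral_tilt {h : ℝ} (hh : 0 ≤ h) {c : Fin n → ℝ} (hc : ∀ i, 0 ≤ c i) :
    (1 + ∑ i, c i)⁻¹ ≤ ∫ v, (1 + tilt n h c v)⁻¹ ∂(stdNormal (Fin (n + 1))) := by
  have hR : 0 ≤ ∑ i, c i := Finset.sum_nonneg fun i _ => hc i
  have ⟨h1, h2⟩ := integral_tangent hh c (1 + ∑ i, c i)⁻¹ ((1 + ∑ i, c i) ^ 2)⁻¹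
  rw [← h2]
  refine integral_mono h1 (integrable_inv_one_add (by fun_prop) (tilt_nonneg hc h)) fun v => ?_
  have hy := tilt_nonneg hc h v
  simp only
  rw [inv_one_add_eq hR hy]
  have : 0 ≤ (tilt n h c v - ∑ i, c i) ^ 2 *
    (((1 + ∑ i, c i) ^ 2)⁻¹ * (1 + tilt n h c v)⁻¹) := by positivity
  linarith

/-- The first-order term of the increment vanishes, and the second-order remainder is controlled
by the variance of the tilt. -/
lemma integral_tilt_inv_one_add_le {h : ℝ} (hh : 0 ≤ h) {c : Fin n → ℝ} (hc : ∀ i, 0 ≤ c i) :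
    ∫ v, (1 + tilt n h c v)⁻¹ ∂(stdNormal (Fin (n + 1))) ≤
      (1 + ∑ i, c i)⁻¹ + (Real.exp (2 * h) - 1) * (1 - (1 + ∑ i, c i)⁻¹) := by
  have hR : 0 ≤ ∑ i, c i := Finset.sum_nonneg fun i _ => hc i
  set R := ∑ i, c i with hRdef
  have ⟨h1, h2⟩ := integral_tangent hh c (1 + R)⁻¹ ((1 + R) ^ 2)⁻¹
  have ⟨h3, h4⟩ := integral_tilt_sub_sq hh hc
  rw [← hRdef] at h1 h2 h3 h4
  have h5 : Integrable (fun v => (tilt n h c v - R) ^ 2 * ((1 + R) ^ 2)⁻¹)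
    (stdNormal (Fin (n + 1))) := h3.mul_const _
  have hE : 0 ≤ Real.exp (2 * h) - 1 := by
    have := Real.add_one_le_exp (2 * h); linarith
  calc ∫ v, (1 + tilt n h c v)⁻¹ ∂(stdNormal (Fin (n + 1)))
      ≤ ∫ v, ((1 + R)⁻¹ - ((1 + R) ^ 2)⁻¹ * (tilt n h c v - R) +
          (tilt n h c v - R) ^ 2 * ((1 + R) ^ 2)⁻¹) ∂(stdNormal (Fin (n + 1))) := by
        refine integral_mono (integrable_inv_one_add (by fun_prop) (tilt_nonneg hc h))
          (h1.add h5) fun v => ?_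
        have hy := tilt_nonneg hc h v
        simp only
        rw [inv_one_add_eq hR hy]
        gcongr
        exact mul_le_of_le_one_right (by positivity) (inv_le_one_of_one_le₀ (by linarith))
    _ ≤ (1 + R)⁻¹ + R ^ 2 * (Real.exp (2 * h) - 1) * ((1 + R) ^ 2)⁻¹ := by
        rw [integral_add h1 h5, h2, integral_mul_const]
        gcongr
    _ ≤ (1 + R)⁻¹ + (Real.exp (2 * h) - 1) * (1 - (1 + R)⁻¹) := by
        have : R ^ 2 * ((1 + R) ^ 2)⁻¹ ≤ 1 - (1 + R)⁻¹ := by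
          have e : 1 - (1 + R)⁻¹ - R ^ 2 * ((1 + R) ^ 2)⁻¹ = R * ((1 + R) ^ 2)⁻¹ := by
            field_simp; ring
          have : 0 ≤ R * ((1 + R) ^ 2)⁻¹ := by positivity
          linarith
        have := mul_le_mul_of_nonneg_left this hE
        linarith

lemma integrable_inv_ratioSum (q : ℝ) :
    Integrable (fun w => (1 + ratioSum n q w)⁻¹) (stdNormal (Fin (n + 1))) :=
  integrable_inv_one_add (measurable_ratioSum q) (ratioSum_nonneg q)

/-- The data processing inequality: less noise gives a larger overlap. -/
lemma overlap_le_overlap_add {q h : ℝ} (hq : 0 ≤ q) (hh : 0 ≤ h) :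
    overlap n q ≤ overlap n (q + h) := by
  have ⟨h1, h2⟩ := integral_comp_ratioSum_add (n := n) hq hh (g := fun y => (1 + y)⁻¹)
    (by fun_prop) (integrable_inv_ratioSum _)
  rw [overlap, overlap, h2]
  exact integral_mono (integrable_inv_ratioSum q) h1 fun w =>
    inv_one_add_le_integral_tilt hh fun i => (weight_pos q w i).le

/-- The overlap grows at most at the rate `2 (1 - overlap)`. -/
lemma overlap_add_le {q h : ℝ} (hq : 0 ≤ q) (hh : 0 ≤ h) :
    overlap n (q + h) ≤ overlap n q + (Real.exp (2 * h) - 1) * (1 - overlap n q) := by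
  have ⟨h1, h2⟩ := integral_comp_ratioSum_add (n := n) hq hh (g := fun y => (1 + y)⁻¹)
    (by fun_prop) (integrable_inv_ratioSum _)
  have i1 := integrable_inv_ratioSum (n := n) q
  have i2 : Integrable (fun w => (Real.exp (2 * h) - 1) * (1 - (1 + ratioSum n q w)⁻¹))
    (stdNormal (Fin (n + 1))) := ((integrable_const (1 : ℝ)).sub i1).const_mul _
  calc overlap n (q + h) ≤ ∫ w, ((1 + ratioSum n q w)⁻¹ +
        (Real.exp (2 * h) - 1) * (1 - (1 + ratioSum n q w)⁻¹)) ∂(stdNormal (Fin (n + 1))) := by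
        rw [overlap, h2]
        exact integral_mono h1 (i1.add i2) fun w =>
          integral_tilt_inv_one_add_le hh fun i => (weight_pos q w i).le
    _ = _ := by
        rw [integral_add i1 i2, integral_const_mul, integral_sub (integrable_const _) i1]
        simp [overlap]

lemma overlap_monotoneOn (n : ℕ) : MonotoneOn (overlap n) (Set.Ici 0) := by
  intro q hq q' _ hqq
  have := overlap_le_overlap_add (n := n) (Set.mem_Ici.1 hq) (sub_nonneg.2 hqq)
  rwa [add_sub_cancel] at this

/-- `K(q) = 𝔼 log(1 + ∑ᵢ (weight ratios))`, the mean of minus the logarithm of the posterior weight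
of the true group. -/
def logLoss (n : ℕ) (q : ℝ) : ℝ :=
  ∫ w, Real.log (1 + ratioSum n q w) ∂(stdNormal (Fin (n + 1)))

lemma integrable_log_one_add {Ω : Type*} [MeasurableSpace Ω] {μ : Measure Ω}
    {g : Ω → ℝ} (hg : Measurable g) (h0 : ∀ w, 0 ≤ g w) (hi : Integrable g μ) :
    Integrable (fun w => Real.log (1 + g w)) μ :=
  hi.mono' (Real.measurable_log.comp (measurable_const.add hg)).aestronglyMeasurable
    (ae_of_all _ fun w => by
    have := h0 w
    rw [Real.norm_of_nonneg (Real.log_nonneg (by linarith))]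
    have := Real.log_le_sub_one_of_pos (show 0 < 1 + g w by linarith)
    linarith)

lemma integrable_log_ratioSum {q : ℝ} (hq : 0 ≤ q) :
    Integrable (fun w => Real.log (1 + ratioSum n q w)) (stdNormal (Fin (n + 1))) :=
  integrable_log_one_add (measurable_ratioSum q) (ratioSum_nonneg q) (integral_ratioSum hq).1

/-- The change of `𝔼 log (1 + y)` along a tilt: concavity bounds it above, and the second-order
remainder bounds it below. -/
lemma integral_log_tilt_mem {h : ℝ} (hh : 0 ≤ h) {c : Fin n → ℝ} (hc : ∀ i, 0 ≤ c i) :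
    ∫ v, Real.log (1 + tilt n h c v) ∂(stdNormal (Fin (n + 1))) ∈
      Set.Icc (Real.log (1 + ∑ i, c i) - (Real.exp (2 * h) - 1) * ∑ i, c i)
        (Real.log (1 + ∑ i, c i)) := by
  have hR : 0 ≤ ∑ i, c i := Finset.sum_nonneg fun i _ => hc i
  set R := ∑ i, c i with hRdef
  have ⟨h1, h2⟩ := integral_tangent hh c (Real.log (1 + R)) (-(1 + R)⁻¹)
  have ⟨h3, h4⟩ := integral_tilt_sub_sq hh hc
  rw [← hRdef] at h1 h2 h3 h4
  have h5 : Integrable (fun v => (tilt n h c v - R) ^ 2 * (1 + R)⁻¹)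
    (stdNormal (Fin (n + 1))) := h3.mul_const _
  have hl : Integrable (fun v => Real.log (1 + tilt n h c v)) (stdNormal (Fin (n + 1))) :=
    integrable_log_one_add (by fun_prop) (tilt_nonneg hc h) (integral_tilt hh c).1
  have hE : 0 ≤ Real.exp (2 * h) - 1 := by
    have := Real.add_one_le_exp (2 * h); linarith
  have key : ∀ v, Real.log (1 + tilt n h c v) = Real.log (1 + R) +
      Real.log ((1 + tilt n h c v) * (1 + R)⁻¹) := by
    intro v
    have hy := tilt_nonneg hc h v
    rw [Real.log_mul (by linarith) (by positivity), Real.log_inv]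
    ring
  constructor
  · calc Real.log (1 + R) - (Real.exp (2 * h) - 1) * R
        ≤ Real.log (1 + R) - R ^ 2 * (Real.exp (2 * h) - 1) * (1 + R)⁻¹ := by
          have : R ^ 2 * (1 + R)⁻¹ ≤ R := by
            rw [← div_eq_mul_inv, div_le_iff₀ (by linarith)]; nlinarith
          have := mul_le_mul_of_nonneg_left this hE
          linarith
      _ ≤ ∫ v, (Real.log (1 + R) - -(1 + R)⁻¹ * (tilt n h c v - R) -
          (tilt n h c v - R) ^ 2 * (1 + R)⁻¹) ∂(stdNormal (Fin (n + 1))) := by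
          rw [integral_sub h1 h5, h2, integral_mul_const]
          gcongr
      _ ≤ _ := by
          refine integral_mono (h1.sub h5) hl fun v => ?_
          have hy := tilt_nonneg hc h v
          simp only
          rw [key v]
          -- `log z ≥ 1 - 1 / z` at `z = (1 + y) / (1 + R)`
          have hz := Real.one_sub_inv_le_log_of_pos
            (show 0 < (1 + tilt n h c v) * (1 + R)⁻¹ by positivity)
          have e : 1 - ((1 + tilt n h c v) * (1 + R)⁻¹)⁻¹ = (1 + R)⁻¹ * (tilt n h c v - R) -
              (tilt n h c v - R) ^ 2 * (1 + R)⁻¹ * (1 + tilt n h c v)⁻¹ := by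
            field_simp; ring
          have : (tilt n h c v - R) ^ 2 * (1 + R)⁻¹ * (1 + tilt n h c v)⁻¹ ≤
              (tilt n h c v - R) ^ 2 * (1 + R)⁻¹ :=
            mul_le_of_le_one_right (by positivity) (inv_le_one_of_one_le₀ (by linarith))
          linarith
  · rw [← h2]
    refine integral_mono hl h1 fun v => ?_
    have hy := tilt_nonneg hc h v
    simp only
    rw [key v]
    have hz := Real.log_le_sub_one_of_pos
      (show 0 < (1 + tilt n h c v) * (1 + R)⁻¹ by positivity)
    have e : (1 + tilt n h c v) * (1 + R)⁻¹ - 1 = (1 + R)⁻¹ * (tilt n h c v - R) := by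
      field_simp; ring
    linarith

lemma logLoss_add_mem {q h : ℝ} (hq : 0 ≤ q) (hh : 0 ≤ h) :
    logLoss n (q + h) ∈ Set.Icc (logLoss n q - (Real.exp (2 * h) - 1) * n) (logLoss n q) := by
  have ⟨h1, h2⟩ := integral_comp_ratioSum_add (n := n) hq hh (g := fun y => Real.log (1 + y))
    (by fun_prop) (integrable_log_ratioSum (add_nonneg hq hh))
  have ⟨h3, h4⟩ := integral_ratioSum (n := n) hq
  have i1 := integrable_log_ratioSum (n := n) hq
  have i2 : Integrable (fun w => (Real.exp (2 * h) - 1) * ratioSum n q w)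
    (stdNormal (Fin (n + 1))) := h3.const_mul _
  constructor
  · have : logLoss n q - (Real.exp (2 * h) - 1) * n = ∫ w, (Real.log (1 + ratioSum n q w) -
        (Real.exp (2 * h) - 1) * ratioSum n q w) ∂(stdNormal (Fin (n + 1))) := by
      rw [integral_sub i1 i2, integral_const_mul, h4, logLoss]
    rw [this, logLoss, h2]
    exact integral_mono (i1.sub i2) h1 fun w =>
      (integral_log_tilt_mem hh fun i => (weight_pos q w i).le).1
  · rw [logLoss, logLoss, h2]
    exact integral_mono h1 i1 fun w =>
      (integral_log_tilt_mem hh fun i => (weight_pos q w i).le).2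

/-- Continuity from an increment bound that is uniform in the starting point. -/
lemma continuousOn_of_increment {F : ℝ → ℝ} {C : ℝ}
    (h : ∀ q h, 0 ≤ q → 0 ≤ h → |F (q + h) - F q| ≤ C * (Real.exp (2 * h) - 1)) :
    ContinuousOn F (Set.Ici 0) := by
  intro q hq
  have hq : 0 ≤ q := hq
  have hb : ∀ y ∈ Set.Ici (0 : ℝ), |F y - F q| ≤ C * (Real.exp (2 * |y - q|) - 1) := by
    intro y hy
    rcases le_total q y with hqy | hqy
    · have := h q (y - q) hq (by linarith)
      rwa [add_sub_cancel, ← abs_of_nonneg (sub_nonneg.2 hqy)] at this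
    · have := h y (q - y) hy (by linarith)
      rwa [add_sub_cancel, ← abs_of_nonneg (sub_nonneg.2 hqy), abs_sub_comm,
        abs_sub_comm q y] at this
  have ht : Tendsto (fun y => C * (Real.exp (2 * |y - q|) - 1)) (𝓝[Set.Ici 0] q) (𝓝 0) := by
    have : Continuous fun y => C * (Real.exp (2 * |y - q|) - 1) := by fun_prop
    have := (this.tendsto q).mono_left (nhdsWithin_le_nhds (s := Set.Ici 0))
    simpa using this
  rw [ContinuousWithinAt, tendsto_iff_norm_sub_tendsto_zero]
  refine squeeze_zero' (Eventually.of_forall fun y => norm_nonneg _) ?_ ht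
  filter_upwards [self_mem_nhdsWithin] with y hy using hb y hy

lemma continuousOn_overlap (n : ℕ) : ContinuousOn (overlap n) (Set.Ici 0) := by
  refine continuousOn_of_increment (C := 1) fun q h hq hh => ?_
  have h1 := overlap_le_overlap_add (n := n) hq hh
  have h2 := overlap_add_le (n := n) hq hh
  have h3 := overlap_nonneg n q
  have hE : 0 ≤ Real.exp (2 * h) - 1 := by
    have := Real.add_one_le_exp (2 * h); linarith
  rw [abs_of_nonneg (by linarith)]
  nlinarith [mul_nonneg hE h3]

lemma continuousOn_logLoss (n : ℕ) : ContinuousOn (logLoss n) (Set.Ici 0) := by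
  refine continuousOn_of_increment (C := n) fun q h hq hh => ?_
  have ⟨h1, h2⟩ := logLoss_add_mem (n := n) hq hh
  rw [abs_of_nonpos (by linarith)]
  linarith

end

/-! ### Bounds on the overlap and the logarithmic loss -/

section

variable {n : ℕ}

/-- An upper bound on the overlap that is sharp at `q = 0`, from the inequality of the arithmetic
and harmonic means. -/
lemma overlap_le_exp {q : ℝ} (hq : 0 ≤ q) :
    overlap n q ≤ (1 + n * Real.exp (2 * q)) / ((n : ℝ) + 1) ^ 2 := by
  have H := fun i : Fin n => integral_exp_sub q hq (-1) i
  have hle : ∀ w : Fin (n + 1) → ℝ, (1 + ratioSum n q w)⁻¹ ≤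
      (1 + ∑ i : Fin n, Real.exp (-1 * (√q * (w i.succ - w 0) - q))) / ((n : ℝ) + 1) ^ 2 := by
    intro w
    have e : ∀ i : Fin n, Real.exp (-1 * (√q * (w i.succ - w 0) - q)) = (weight n q w i)⁻¹ := by
      intro i; rw [weight, ← Real.exp_neg]; ring_nf
    simp_rw [e]
    have hR := ratioSum_nonneg q w
    have hT : 0 ≤ ∑ i, (weight n q w i)⁻¹ :=
      Finset.sum_nonneg fun i _ => inv_nonneg.2 (weight_pos q w i).le
    have hcs := Finset.sum_sq_le_sum_mul_sum_of_sq_le_mul Finset.univ (r := fun _ : Fin n => (1 : ℝ))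
      (f := weight n q w) (g := fun i => (weight n q w i)⁻¹) (fun i _ => (weight_pos q w i).le)
      (fun i _ => inv_nonneg.2 (weight_pos q w i).le)
      (fun i _ => by rw [mul_inv_cancel₀ (weight_pos q w i).ne']; norm_num)
    rw [← ratioSum] at hcs
    set T := ∑ i, (weight n q w i)⁻¹
    set R := ratioSum n q w
    have hcs : (n : ℝ) ^ 2 ≤ R * T := by simpa using hcs
    have h2 : 2 * (n : ℝ) ≤ R + T := by
      apply le_of_sq_le_sq _ (by positivity)
      nlinarith [sq_nonneg (R - T)]
    rw [inv_eq_one_div, div_le_div_iff₀ (by linarith) (by positivity)]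
    nlinarith
  have hint : Integrable (fun w : Fin (n + 1) → ℝ =>
      ∑ i : Fin n, Real.exp (-1 * (√q * (w i.succ - w 0) - q))) (stdNormal (Fin (n + 1))) :=
    integrable_finsetSum _ fun i _ => (H i).1
  refine (integral_mono (integrable_inv_ratioSum q)
    (((integrable_const _).add hint).div_const _) hle).trans_eq ?_
  rw [integral_div, integral_add' (integrable_const _) hint,
    integral_finsetSum _ fun i _ => (H i).1]
  simp_rw [(H _).2]
  norm_num

/-- The empirical mean of the exponential martingales of the wrong groups. -/
def wrongMean (n : ℕ) (q : ℝ) (w : Fin (n + 1) → ℝ) : ℝ :=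
  (n : ℝ)⁻¹ * ∑ i : Fin n, Real.exp (√q * w i.succ - q / 2)

/-- The logarithm of the ratio of the mean total weight of the wrong groups to the weight of the
true group. -/
def logRatio (n : ℕ) (q : ℝ) (w : Fin (n + 1) → ℝ) : ℝ := Real.log n - q / 2 - √q * w 0

lemma wrongMean_nonneg (q : ℝ) (w : Fin (n + 1) → ℝ) : 0 ≤ wrongMean n q w := by
  unfold wrongMean; positivity

lemma ratioSum_eq_mul (hn : 0 < n) (q : ℝ) (w : Fin (n + 1) → ℝ) :
    ratioSum n q w = Real.exp (logRatio n q w) * wrongMean n q w := by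
  have hn' : (0 : ℝ) < n := Nat.cast_pos.2 hn
  rw [logRatio, wrongMean, ratioSum, sub_sub, Real.exp_sub, Real.exp_log hn', Finset.mul_sum,
    Finset.mul_sum]
  refine Finset.sum_congr rfl fun i _ => ?_
  have : weight n q w i = Real.exp (√q * w i.succ - q / 2) / Real.exp (q / 2 + √q * w 0) := by
    rw [weight, ← Real.exp_sub]; ring_nf
  rw [this]
  field_simp

/-- `wrongMean` has mean one and is independent of the true group. -/
lemma integral_exp_mul_wrongMean (hn : 0 < n) {q : ℝ} (hq : 0 ≤ q) (a : ℝ) :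
    Integrable (fun w => Real.exp (a * w 0) * wrongMean n q w) (stdNormal (Fin (n + 1))) ∧
    ∫ w, Real.exp (a * w 0) * wrongMean n q w ∂(stdNormal (Fin (n + 1))) =
      Real.exp (a ^ 2 / 2) := by
  have hn' : (n : ℝ) ≠ 0 := Nat.cast_ne_zero.2 hn.ne'
  have H := fun i : Fin n => integral_exp_pair a (√q) i
  have e : (fun w => Real.exp (a * w 0) * wrongMean n q w) = fun w : Fin (n + 1) → ℝ =>
      ((n : ℝ)⁻¹ * Real.exp (-(q / 2))) * ∑ i : Fin n, Real.exp (a * w 0 + √q * w i.succ) := by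
    ext w
    rw [wrongMean, Finset.mul_sum, Finset.mul_sum, Finset.mul_sum]
    refine Finset.sum_congr rfl fun i _ => ?_
    rw [sub_eq_add_neg, Real.exp_add, Real.exp_add]
    ring
  rw [e]
  refine ⟨(integrable_finsetSum _ fun i _ => (H i).1).const_mul _, ?_⟩
  rw [integral_const_mul, integral_finsetSum _ fun i _ => (H i).1]
  simp_rw [(H _).2]
  simp only [Finset.sum_const, Finset.card_univ, Fintype.card_fin, nsmul_eq_mul]
  rw [Real.sq_sqrt hq]
  calc _ = Real.exp (-(q / 2)) * Real.exp ((a ^ 2 + q) / 2) := by field_simp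
    _ = _ := by rw [← Real.exp_add]; ring_nf

lemma integral_exp_zero (n : ℕ) (a : ℝ) :
    Integrable (fun w : Fin (n + 1) → ℝ => Real.exp (a * w 0)) (stdNormal (Fin (n + 1))) ∧
    ∫ w : Fin (n + 1) → ℝ, Real.exp (a * w 0) ∂(stdNormal (Fin (n + 1))) =
      Real.exp (a ^ 2 / 2) := by
  simpa using integral_exp_cons (n := n) a 0

lemma integral_wrongMean (hn : 0 < n) {q : ℝ} (hq : 0 ≤ q) :
    Integrable (wrongMean n q) (stdNormal (Fin (n + 1))) ∧
    ∫ w, wrongMean n q w ∂(stdNormal (Fin (n + 1))) = 1 := by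
  simpa using integral_exp_mul_wrongMean hn hq 0

/-- Recovery: the overlap is close to one for `q > 2 log n`, on choosing `θ` small. -/
lemma one_sub_overlap_le (hn : 0 < n) {q : ℝ} (hq : 0 ≤ q) {θ : ℝ} (h0 : 0 ≤ θ) (h1 : θ ≤ 1) :
    1 - overlap n q ≤ 2 * Real.exp (θ * Real.log n - θ * (1 - θ) * q / 2) := by
  have ⟨i1, e1⟩ := integral_exp_zero n (-(θ * √q))
  have ⟨i2, e2⟩ := integral_exp_mul_wrongMean hn hq (-(θ * √q))
  set c := Real.exp (θ * (Real.log n - q / 2)) with hc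
  have i3 := integrable_inv_ratioSum (n := n) q
  have hpt : ∀ w, 1 - (1 + ratioSum n q w)⁻¹ ≤ c * (Real.exp (-(θ * √q) * w 0) +
      Real.exp (-(θ * √q) * w 0) * wrongMean n q w) := by
    intro w
    have e : c * Real.exp (-(θ * √q) * w 0) = Real.exp (θ * logRatio n q w) := by
      rw [hc, ← Real.exp_add, logRatio]; ring_nf
    have hR := ratioSum_nonneg q w
    have hS := wrongMean_nonneg q w
    have hRS := ratioSum_eq_mul hn q w
    rw [mul_add, ← mul_assoc, e]
    set z := logRatio n q w
    have hpos := Real.exp_pos (θ * z)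
    rcases le_total 0 z with hz | hz
    · have h2 : (1 : ℝ) ≤ Real.exp (θ * z) := Real.one_le_exp (mul_nonneg h0 hz)
      have h3 : 0 < (1 + ratioSum n q w)⁻¹ := by positivity
      have := mul_nonneg hpos.le hS
      linarith
    · have h2 : Real.exp z ≤ Real.exp (θ * z) := Real.exp_le_exp.2 (by nlinarith)
      have h3 : 1 - (1 + ratioSum n q w)⁻¹ ≤ ratioSum n q w := by
        have : 1 - (1 + ratioSum n q w)⁻¹ = ratioSum n q w * (1 + ratioSum n q w)⁻¹ := by
          field_simp; ring
        rw [this]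
        exact mul_le_of_le_one_right hR (inv_le_one_of_one_le₀ (by linarith))
      have := mul_le_mul_of_nonneg_right h2 hS
      linarith
  have hmono := integral_mono ((integrable_const (1 : ℝ)).sub i3) ((i1.add i2).const_mul c) hpt
  rw [integral_const_mul, integral_add' i1 i2, e1, e2, integral_sub' (integrable_const _) i3] at hmono
  refine (show 1 - overlap n q ≤ _ by simpa [overlap] using hmono).trans_eq ?_
  rw [← two_mul, mul_left_comm, hc, ← Real.exp_add, mul_pow, Real.sq_sqrt hq]
  ring_nf

/-- The upper bound `K(q) ≤ (log n - q / 2)⁺ + O(√q)` on the logarithmic loss. -/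
lemma logLoss_le (hn : 0 < n) {q : ℝ} (hq : 0 ≤ q) :
    logLoss n q ≤ 2 + max (Real.log n - q / 2) 0 + 4 * √q := by
  have ⟨i1, e1⟩ := integral_exp_zero n 1
  have ⟨i2, e2⟩ := integral_exp_zero n (-1)
  have ⟨i3, e3⟩ := integral_wrongMean hn hq
  have hpt : ∀ w, Real.log (1 + ratioSum n q w) ≤ (Real.log 2 + max (Real.log n - q / 2) 0) +
      √q * (Real.exp (1 * w 0) + Real.exp (-1 * w 0)) + wrongMean n q w := by
    intro w
    have hS := wrongMean_nonneg q w
    rw [ratioSum_eq_mul hn]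
    set z := logRatio n q w with hz
    have hez := Real.exp_pos z
    have h1 : Real.log (1 + Real.exp z * wrongMean n q w) ≤
        Real.log (1 + Real.exp z) + wrongMean n q w := by
      have h2 := Real.log_le_sub_one_of_pos (show 0 < 1 + wrongMean n q w by linarith)
      have h3 : Real.log (1 + Real.exp z * wrongMean n q w) ≤
          Real.log ((1 + Real.exp z) * (1 + wrongMean n q w)) :=
        Real.log_le_log (by positivity) (by nlinarith)
      rw [Real.log_mul (by positivity) (by positivity)] at h3
      linarith
    have h2 : Real.log (1 + Real.exp z) ≤ Real.log 2 + max z 0 := by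
      have h3 : 1 + Real.exp z ≤ 2 * Real.exp (max z 0) := by
        have := Real.exp_le_exp.2 (le_max_left z 0)
        have := Real.one_le_exp (le_max_right z 0)
        linarith
      have h4 := Real.log_le_log (by positivity) h3
      rwa [Real.log_mul (by norm_num) (Real.exp_pos _).ne', Real.log_exp] at h4
    have h3 : max z 0 ≤ max (Real.log n - q / 2) 0 + √q * |w 0| := by
      have := mul_le_mul_of_nonneg_left (neg_abs_le (w 0)) (Real.sqrt_nonneg q)
      have := mul_nonneg (Real.sqrt_nonneg q) (abs_nonneg (w 0))
      apply max_le
      · rw [hz, logRatio]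
        have := le_max_left (Real.log n - q / 2) 0
        linarith
      · have := le_max_right (Real.log n - q / 2) 0
        linarith
    have h4 : |w 0| ≤ Real.exp (1 * w 0) + Real.exp (-1 * w 0) := by
      have h5 := Real.add_one_le_exp (1 * w 0)
      have h6 := Real.add_one_le_exp (-1 * w 0)
      have h7 := Real.exp_pos (1 * w 0)
      have h8 := Real.exp_pos (-1 * w 0)
      rw [abs_le]
      constructor <;> linarith
    have := mul_le_mul_of_nonneg_left h4 (Real.sqrt_nonneg q)
    linarith
  have i4 : Integrable (fun w : Fin (n + 1) → ℝ =>
      √q * (Real.exp (1 * w 0) + Real.exp (-1 * w 0))) (stdNormal (Fin (n + 1))) :=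
    (i1.add i2).const_mul _
  have i5 : Integrable (fun w : Fin (n + 1) → ℝ => (Real.log 2 + max (Real.log n - q / 2) 0) +
      √q * (Real.exp (1 * w 0) + Real.exp (-1 * w 0))) (stdNormal (Fin (n + 1))) :=
    (integrable_const _).add i4
  refine (integral_mono (integrable_log_ratioSum hq) (i5.add i3) hpt).trans ?_
  rw [integral_add' i5 i3, integral_add (integrable_const _) i4, integral_const_mul,
    integral_add i1 i2, e1, e2, e3]
  have h1 : Real.exp (1 / 2) ≤ 2 := by
    rw [← Real.le_log_iff_exp_le two_pos]
    linarith [Real.log_two_gt_d9]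
  have h2 : Real.log 2 ≤ 1 := by linarith [Real.log_two_lt_d9]
  have h3 := mul_le_mul_of_nonneg_left h1 (Real.sqrt_nonneg q)
  norm_num at h3 ⊢
  linarith

lemma gaussianReal_real_Ioi_ge {τ : ℝ} (hτ : 0 ≤ τ) :
    (√(2 * Real.pi))⁻¹ * Real.exp (-(τ + 1) ^ 2 / 2) ≤ (gaussianReal 0 1).real (Set.Ioi τ) := by
  have h1 : ∫ x in Set.Ioc τ (τ + 1), (√(2 * Real.pi))⁻¹ * Real.exp (-(τ + 1) ^ 2 / 2) ≤
      ∫ x in Set.Ioc τ (τ + 1), gaussianPDFReal 0 1 x := by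
    refine setIntegral_mono_on (integrableOn_const (by simp))
      (integrable_gaussianPDFReal 0 1).integrableOn measurableSet_Ioc fun x hx => ?_
    rw [gaussianPDFReal]
    simp only [NNReal.coe_one, mul_one, sub_zero]
    gcongr ?_ * Real.exp ?_
    have : x ^ 2 ≤ (τ + 1) ^ 2 := pow_le_pow_left₀ (by linarith [hx.1]) hx.2 2
    linarith
  have h2 : (gaussianReal 0 1).real (Set.Ioc τ (τ + 1)) =
      ∫ x in Set.Ioc τ (τ + 1), gaussianPDFReal 0 1 x := by
    rw [measureReal_def, gaussianReal_apply_eq_integral 0 one_ne_zero,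
      ENNReal.toReal_ofReal (integral_nonneg fun x => gaussianPDFReal_nonneg 0 1 x)]
  refine le_trans ?_ (measureReal_mono (fun x (hx : x ∈ Set.Ioc τ (τ + 1)) => hx.1))
  rw [h2]
  refine le_trans (le_of_eq ?_) h1
  simp

/-- No recovery: as soon as one of the wrong groups exceeds the level `τ`, it dominates the true
group, up to an exceptional event controlled by `θ`. -/
lemma overlap_le_pow_add_exp {q : ℝ} (hq : 0 ≤ q) (τ : ℝ) {θ : ℝ} (h0 : 0 ≤ θ) (h1 : θ ≤ 1) :
    overlap n q ≤ (gaussianReal 0 1).real (Set.Iic τ) ^ n +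
      Real.exp (θ * (q - √q * τ) + θ ^ 2 * q / 2) := by
  set F : Fin (n + 1) → ℝ → ℝ := Fin.cons (fun _ => 1) fun _ => (Set.Iic τ).indicator 1 with hF
  have hFi : ∀ j, Integrable (F j) (gaussianReal 0 1) := by
    intro j
    refine Fin.cases ?_ (fun i => ?_) j
    · simp [hF]
    · simp only [hF, Fin.cons_succ]
      exact (integrable_const (1 : ℝ)).indicator measurableSet_Iic
  have i1 : Integrable (fun w : Fin (n + 1) → ℝ => ∏ j, F j (w j)) (stdNormal (Fin (n + 1))) :=
    Integrable.fintype_prod hFi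
  have e1 : ∫ w : Fin (n + 1) → ℝ, ∏ j, F j (w j) ∂(stdNormal (Fin (n + 1))) =
      (gaussianReal 0 1).real (Set.Iic τ) ^ n := by
    rw [integral_fintype_prod_eq_prod, Fin.prod_univ_succ]
    simp [hF, integral_indicator_one measurableSet_Iic]
  have ⟨i2, e2⟩ := integral_exp_zero n (θ * √q)
  have i3 := i2.const_mul (Real.exp (θ * (q - √q * τ)))
  have hpt : ∀ w, (1 + ratioSum n q w)⁻¹ ≤ ∏ j, F j (w j) +
      Real.exp (θ * (q - √q * τ)) * Real.exp (θ * √q * w 0) := by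
    intro w
    have hR := ratioSum_nonneg q w
    have hle1 : (1 + ratioSum n q w)⁻¹ ≤ 1 := inv_le_one_of_one_le₀ (by linarith)
    by_cases hall : ∀ i : Fin n, w i.succ ≤ τ
    · have : ∏ j, F j (w j) = 1 := by
        rw [Fin.prod_univ_succ]
        simp [hF, hall]
      rw [this]
      have : 0 < Real.exp (θ * (q - √q * τ)) * Real.exp (θ * √q * w 0) := by positivity
      linarith
    · push Not at hall
      obtain ⟨i, hi⟩ := hall
      have hP : 0 ≤ ∏ j, F j (w j) := by
        refine Finset.prod_nonneg fun j _ => ?_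
        refine Fin.cases ?_ (fun i => ?_) j
        · simp [hF]
        · simp only [hF, Fin.cons_succ]
          exact Set.indicator_nonneg (fun _ _ => zero_le_one) _
      set y := q + √q * w 0 - √q * τ with hy
      have hRy : Real.exp (-y) ≤ ratioSum n q w := by
        refine le_trans ?_ (Finset.single_le_sum (f := weight n q w)
          (fun i _ => (weight_pos q w i).le) (Finset.mem_univ i))
        rw [weight]
        refine Real.exp_le_exp.2 ?_
        have := mul_le_mul_of_nonneg_left hi.le (Real.sqrt_nonneg q)
        rw [hy]; linarith
      have hle2 : (1 + ratioSum n q w)⁻¹ ≤ Real.exp y := by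
        rw [← neg_neg y, Real.exp_neg (-y)]
        exact inv_anti₀ (Real.exp_pos _) (by linarith)
      have e : Real.exp (θ * (q - √q * τ)) * Real.exp (θ * √q * w 0) = Real.exp (θ * y) := by
        rw [← Real.exp_add, hy]; ring_nf
      rw [e]
      have : (1 + ratioSum n q w)⁻¹ ≤ Real.exp (θ * y) := by
        rcases le_total 0 y with h | h
        · exact hle1.trans (Real.one_le_exp (mul_nonneg h0 h))
        · exact hle2.trans (Real.exp_le_exp.2 (by nlinarith))
      linarith
  refine (integral_mono (integrable_inv_ratioSum q) (i1.add i3) hpt).trans_eq ?_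
  rw [integral_add' i1 i3, e1, integral_const_mul, e2, ← Real.exp_add, mul_pow, Real.sq_sqrt hq]

end

/-! ### Expansion of the overlap at the origin -/

section

variable {n : ℕ}

lemma integral_weight_mul {h : ℝ} (hh : 0 ≤ h) (i j : Fin n) :
    Integrable (fun w => weight n h w i * weight n h w j) (stdNormal (Fin (n + 1))) ∧
    ∫ w, weight n h w i * weight n h w j ∂(stdNormal (Fin (n + 1))) =
      if i = j then Real.exp (2 * h) else Real.exp h := by
  split_ifs with hij
  · subst hij
    have ⟨h1, h2⟩ := integral_exp_sub h hh 2 i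
    have e : (fun w => weight n h w i * weight n h w i) =
        fun v : Fin (n + 1) → ℝ => Real.exp (2 * (√h * (v i.succ - v 0) - h)) := by
      ext v; rw [weight, ← Real.exp_add, two_mul]
    rw [e]
    refine ⟨h1, h2.trans ?_⟩
    norm_num
  · have ⟨h1, h2⟩ := integral_exp_cons (-(2 * √h)) (Pi.single i (√h) + Pi.single j (√h))
    have e : (fun w => weight n h w i * weight n h w j) =
        fun w : Fin (n + 1) → ℝ => Real.exp (-(2 * h)) * Real.exp (-(2 * √h) * w 0 +
          ∑ k, (Pi.single i (√h) + Pi.single j (√h) : Fin n → ℝ) k * w k.succ) := by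
      ext w
      rw [weight, weight, ← Real.exp_add, ← Real.exp_add]
      simp only [Pi.add_apply, Pi.single_apply, add_mul, ite_mul, zero_mul,
        Finset.sum_add_distrib, Finset.sum_ite_eq', Finset.mem_univ, if_true]
      ring_nf
    have e2 : ∑ k, (Pi.single i (√h) + Pi.single j (√h) : Fin n → ℝ) k ^ 2 = 2 * h := by
      have : ∀ k, (Pi.single i (√h) + Pi.single j (√h) : Fin n → ℝ) k ^ 2 =
          (if k = i then h else 0) + (if k = j then h else 0) := by
        intro k
        by_cases hki : k = i
        · subst hki; simp [hij, hh]
        · by_cases hkj : k = j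
          · subst hkj; simp [hki, hh]
          · simp [hki, hkj]
      simp_rw [this]
      simp [Finset.sum_add_distrib]
      ring
    rw [e]
    refine ⟨h1.const_mul _, ?_⟩
    rw [integral_const_mul, h2, e2, ← Real.exp_add, neg_sq, mul_pow, Real.sq_sqrt hh]
    ring_nf

lemma integral_weight {h : ℝ} (hh : 0 ≤ h) (i : Fin n) :
    Integrable (fun w => weight n h w i) (stdNormal (Fin (n + 1))) ∧
    ∫ w, weight n h w i ∂(stdNormal (Fin (n + 1))) = 1 := by
  simpa [weight] using integral_exp_sub h hh 1 i

/-- The covariance matrix of the weight ratios; distinct ratios are correlated through the true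
group. -/
lemma integral_weight_cov {h : ℝ} (hh : 0 ≤ h) (i j : Fin n) :
    Integrable (fun w => (weight n h w i - 1) * (weight n h w j - 1))
      (stdNormal (Fin (n + 1))) ∧
    ∫ w, (weight n h w i - 1) * (weight n h w j - 1) ∂(stdNormal (Fin (n + 1))) =
      if i = j then Real.exp (2 * h) - 1 else Real.exp h - 1 := by
  have ⟨h1, h2⟩ := integral_weight_mul hh i j
  have ⟨h3, h4⟩ := integral_weight hh i
  have ⟨h5, h6⟩ := integral_weight hh j
  have e : (fun w => (weight n h w i - 1) * (weight n h w j - 1)) =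
      fun w => (weight n h w i * weight n h w j - weight n h w i) - (weight n h w j - 1) := by
    ext w; ring
  have i1 : Integrable (fun w => weight n h w i * weight n h w j - weight n h w i)
    (stdNormal (Fin (n + 1))) := h1.sub h3
  have i2 : Integrable (fun w => weight n h w j - 1) (stdNormal (Fin (n + 1))) :=
    h5.sub (integrable_const _)
  rw [e]
  refine ⟨i1.sub i2, ?_⟩
  rw [integral_sub i1 i2, integral_sub h1 h3, integral_sub h5 (integrable_const _), h2, h4, h6]
  split_ifs <;> simp

/-- The variance `n (exp(2h) - 1) + n (n - 1) (exp h - 1)` of the total weight of the wrong groups. -/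
def ratioVar (n : ℕ) (h : ℝ) : ℝ :=
  n * (Real.exp (2 * h) - 1) + n * (n - 1) * (Real.exp h - 1)

lemma integral_ratioSum_sub_sq {h : ℝ} (hh : 0 ≤ h) :
    Integrable (fun w => (ratioSum n h w - n) ^ 2) (stdNormal (Fin (n + 1))) ∧
    ∫ w, (ratioSum n h w - n) ^ 2 ∂(stdNormal (Fin (n + 1))) = ratioVar n h := by
  have H := fun i j : Fin n => integral_weight_cov hh i j
  have e : (fun w => (ratioSum n h w - n) ^ 2) =
      fun w => ∑ i, ∑ j, (weight n h w i - 1) * (weight n h w j - 1) := by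
    ext w
    rw [← Finset.sum_mul_sum, ← sq, Finset.sum_sub_distrib]
    simp [ratioSum]
  have i1 : ∀ i, Integrable (fun w => ∑ j, (weight n h w i - 1) * (weight n h w j - 1))
      (stdNormal (Fin (n + 1))) := fun i => integrable_finsetSum _ fun j _ => (H i j).1
  rw [e]
  refine ⟨integrable_finsetSum _ fun i _ => i1 i, ?_⟩
  rw [integral_finsetSum _ fun i _ => i1 i]
  simp_rw [integral_finsetSum _ fun j _ => (H _ j).1, (H _ _).2]
  have : ∀ i j : Fin n, (if i = j then Real.exp (2 * h) - 1 else Real.exp h - 1) =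
      (Real.exp h - 1) + if i = j then Real.exp (2 * h) - Real.exp h else 0 := by
    intro i j; split_ifs <;> ring
  simp_rw [this, Finset.sum_add_distrib]
  simp [ratioVar]
  ring

lemma integral_ratioSum_sub_pow_four {h : ℝ} (hh : 0 ≤ h) :
    Integrable (fun w => (ratioSum n h w - n) ^ 4) (stdNormal (Fin (n + 1))) ∧
    ∫ w, (ratioSum n h w - n) ^ 4 ∂(stdNormal (Fin (n + 1))) ≤ n ^ 4 *
      (Real.exp (12 * h) - 4 * Real.exp (6 * h) + 6 * Real.exp (2 * h) - 3) := by
  have hb : ∀ i : Fin n, Integrable (fun w => (weight n h w i - 1) ^ 4)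
      (stdNormal (Fin (n + 1))) ∧
      ∫ w, (weight n h w i - 1) ^ 4 ∂(stdNormal (Fin (n + 1))) =
        Real.exp (12 * h) - 4 * Real.exp (6 * h) + 6 * Real.exp (2 * h) - 3 := by
    intro i
    have H := fun k : ℝ => integral_exp_sub h hh k i
    have e : (fun w => (weight n h w i - 1) ^ 4) = fun w : Fin (n + 1) → ℝ =>
        (Real.exp (4 * (√h * (w i.succ - w 0) - h)) +
          (-4) * Real.exp (3 * (√h * (w i.succ - w 0) - h))) +
        (6 * Real.exp (2 * (√h * (w i.succ - w 0) - h)) +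
          ((-4) * Real.exp (1 * (√h * (w i.succ - w 0) - h)) + 1)) := by
      ext w
      have p : ∀ k : ℕ, Real.exp (k * (√h * (w i.succ - w 0) - h)) = weight n h w i ^ k :=
        fun k => by rw [weight, Real.exp_nat_mul]
      have p4 := p 4; have p3 := p 3; have p2 := p 2; have p1 := p 1
      push_cast at p4 p3 p2 p1
      rw [p4, p3, p2, p1]
      ring
    have j1 : Integrable (fun w : Fin (n + 1) → ℝ =>
        Real.exp (4 * (√h * (w i.succ - w 0) - h)) +
          (-4) * Real.exp (3 * (√h * (w i.succ - w 0) - h))) (stdNormal (Fin (n + 1))) :=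
      (H 4).1.add ((H 3).1.const_mul _)
    have j2 : Integrable (fun w : Fin (n + 1) → ℝ =>
        (-4) * Real.exp (1 * (√h * (w i.succ - w 0) - h)) + 1) (stdNormal (Fin (n + 1))) :=
      ((H 1).1.const_mul _).add (integrable_const _)
    have j3 : Integrable (fun w : Fin (n + 1) → ℝ =>
        6 * Real.exp (2 * (√h * (w i.succ - w 0) - h)) +
          ((-4) * Real.exp (1 * (√h * (w i.succ - w 0) - h)) + 1)) (stdNormal (Fin (n + 1))) :=
      ((H 2).1.const_mul _).add j2
    rw [e]
    refine ⟨j1.add j3, ?_⟩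
    rw [integral_add j1 j3, integral_add (H 4).1 ((H 3).1.const_mul _),
      integral_add ((H 2).1.const_mul _) j2, integral_add ((H 1).1.const_mul _)
        (integrable_const _), integral_const_mul, integral_const_mul, integral_const_mul,
      (H 4).2, (H 3).2, (H 2).2, (H 1).2]
    norm_num
    ring
  have hle : ∀ w, (ratioSum n h w - n) ^ 4 ≤ n ^ 3 * ∑ i, (weight n h w i - 1) ^ 4 := by
    intro w
    have e : ratioSum n h w - n = ∑ i, (weight n h w i - 1) := by
      rw [Finset.sum_sub_distrib]; simp [ratioSum]
    rw [e]
    have h1 := sq_sum_le_card_mul_sum_sq (s := Finset.univ) (f := fun i => weight n h w i - 1)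
    have h2 := sq_sum_le_card_mul_sum_sq (s := Finset.univ)
      (f := fun i => (weight n h w i - 1) ^ 2)
    simp only [Finset.card_univ, Fintype.card_fin, ← pow_mul] at h1 h2
    norm_num at h2
    have h3 := pow_le_pow_left₀ (sq_nonneg _) h1 2
    calc (∑ i, (weight n h w i - 1)) ^ 4 = ((∑ i, (weight n h w i - 1)) ^ 2) ^ 2 := by ring
      _ ≤ _ := h3
      _ = n ^ 2 * (∑ i, (weight n h w i - 1) ^ 2) ^ 2 := by ring
      _ ≤ n ^ 2 * (n * ∑ i, (weight n h w i - 1) ^ 4) := by gcongr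
      _ = _ := by ring
  have hint : Integrable (fun w => (n : ℝ) ^ 3 * ∑ i, (weight n h w i - 1) ^ 4)
      (stdNormal (Fin (n + 1))) := (integrable_finsetSum _ fun i _ => (hb i).1).const_mul _
  have hint' : Integrable (fun w => (ratioSum n h w - n) ^ 4) (stdNormal (Fin (n + 1))) :=
    hint.mono' (by fun_prop) (ae_of_all _ fun w => by
      rw [Real.norm_of_nonneg (by positivity)]; exact hle w)
  refine ⟨hint', (integral_mono hint' hint hle).trans_eq ?_⟩
  rw [integral_const_mul, integral_finsetSum _ fun i _ => (hb i).1]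
  simp_rw [(hb _).2]
  simp
  ring

/-- Second-order expansion of the overlap at `q = 0`. The third absolute moment in the remainder is
interpolated between the second and the fourth. -/
lemma abs_overlap_sub_le {h : ℝ} (hh : 0 ≤ h) {l : ℝ} (hl : 0 < l) :
    |overlap n h - ((n : ℝ) + 1)⁻¹ - ratioVar n h * (((n : ℝ) + 1) ^ 3)⁻¹| ≤
      l * ratioVar n h / 2 + (n ^ 4 * (Real.exp (12 * h) - 4 * Real.exp (6 * h) +
        6 * Real.exp (2 * h) - 3)) / l / 2 := by
  have ⟨i1, e1⟩ := integral_ratioSum (n := n) hh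
  have ⟨i2, e2⟩ := integral_ratioSum_sub_sq (n := n) hh
  have ⟨i4, e4⟩ := integral_ratioSum_sub_pow_four (n := n) hh
  have i0 := integrable_inv_ratioSum (n := n) h
  have hn : (0 : ℝ) < n + 1 := by positivity
  have j1 : Integrable (fun w => (1 + ratioSum n h w)⁻¹ - ((n : ℝ) + 1)⁻¹)
    (stdNormal (Fin (n + 1))) := i0.sub (integrable_const _)
  have j2 : Integrable (fun w => (((n : ℝ) + 1) ^ 2)⁻¹ * (ratioSum n h w - n))
    (stdNormal (Fin (n + 1))) := (i1.sub (integrable_const _)).const_mul _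
  have j3 : Integrable (fun w => (ratioSum n h w - n) ^ 2 * (((n : ℝ) + 1) ^ 3)⁻¹)
    (stdNormal (Fin (n + 1))) := i2.mul_const _
  have j4 : Integrable (fun w => ((1 + ratioSum n h w)⁻¹ - ((n : ℝ) + 1)⁻¹) +
    (((n : ℝ) + 1) ^ 2)⁻¹ * (ratioSum n h w - n)) (stdNormal (Fin (n + 1))) := j1.add j2
  have e : overlap n h - ((n : ℝ) + 1)⁻¹ - ratioVar n h * (((n : ℝ) + 1) ^ 3)⁻¹ =
      ∫ w, (((1 + ratioSum n h w)⁻¹ - ((n : ℝ) + 1)⁻¹) +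
        (((n : ℝ) + 1) ^ 2)⁻¹ * (ratioSum n h w - n) -
        (ratioSum n h w - n) ^ 2 * (((n : ℝ) + 1) ^ 3)⁻¹) ∂(stdNormal (Fin (n + 1))) := by
    rw [integral_sub j4 j3, integral_add j1 j2, integral_sub i0 (integrable_const _),
      integral_const_mul, integral_sub i1 (integrable_const _), e1, integral_mul_const, e2]
    simp [overlap]
  have k2 : Integrable (fun w => l * (ratioSum n h w - n) ^ 2 / 2) (stdNormal (Fin (n + 1))) :=
    (i2.const_mul l).div_const 2
  have k4 : Integrable (fun w => (ratioSum n h w - n) ^ 4 / l / 2) (stdNormal (Fin (n + 1))) :=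
    (i4.div_const l).div_const 2
  rw [e, ← Real.norm_eq_abs]
  refine (norm_integral_le_of_norm_le (k2.add k4) (ae_of_all _ fun w => ?_)).trans ?_
  · have hR := ratioSum_nonneg h w
    set R := ratioSum n h w
    have e3 : ((1 + R)⁻¹ - ((n : ℝ) + 1)⁻¹) + (((n : ℝ) + 1) ^ 2)⁻¹ * (R - n) -
        (R - n) ^ 2 * (((n : ℝ) + 1) ^ 3)⁻¹ =
        -((R - n) ^ 3) * ((((n : ℝ) + 1) ^ 3)⁻¹ * (1 + R)⁻¹) := by
      field_simp
      ring
    rw [e3, Real.norm_eq_abs, abs_mul, abs_neg, abs_pow]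
    have h1 : |(((n : ℝ) + 1) ^ 3)⁻¹ * (1 + R)⁻¹| ≤ 1 := by
      rw [abs_of_nonneg (by positivity)]
      refine mul_le_one₀ (inv_le_one_of_one_le₀ (one_le_pow₀ ?_)) (by positivity)
        (inv_le_one_of_one_le₀ (by linarith))
      linarith [Nat.cast_nonneg (α := ℝ) n]
    refine (mul_le_of_le_one_right (by positivity) h1).trans ?_
    simp only [Pi.add_apply]
    rw [← sq_abs (R - n), ← Even.pow_abs (show Even 4 by decide) (R - n)]
    set a := |R - n|
    have ha : 0 ≤ a := abs_nonneg _
    have e5 : l * a ^ 2 / 2 + a ^ 4 / l / 2 - a ^ 3 = a ^ 2 * (l - a) ^ 2 / (2 * l) := by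
      field_simp; ring
    have : 0 ≤ a ^ 2 * (l - a) ^ 2 / (2 * l) := by positivity
    linarith
  · rw [integral_add' k2 k4, integral_div, integral_const_mul, e2, integral_div, integral_div]
    gcongr

/-- The overlap has right derivative `n / (n + 1)²` at `q = 0`. -/
lemma tendsto_overlap_slope (n : ℕ) :
    Tendsto (fun h => h⁻¹ * (overlap n h - ((n : ℝ) + 1)⁻¹)) (𝓝[>] 0)
      (𝓝 (n / ((n : ℝ) + 1) ^ 2)) := by
  have hE : ∀ k : ℝ, HasDerivAt (fun h : ℝ => Real.exp (k * h)) k 0 := by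
    intro k
    simpa using ((hasDerivAt_id (0 : ℝ)).const_mul k).exp
  have hV : HasDerivAt (ratioVar n) (n * (n + 1)) 0 := by
    have h1 := (((hE 2).sub_const 1).const_mul (n : ℝ)).add
      (((hE 1).sub_const 1).const_mul ((n : ℝ) * (n - 1)))
    rw [show (n : ℝ) * (n + 1) = n * 2 + n * (n - 1) * 1 by ring]
    exact h1.congr_of_eventuallyEq (Eventually.of_forall fun h => by simp [ratioVar])
  have hA : Tendsto (fun h => h⁻¹ * ratioVar n h) (𝓝[>] 0) (𝓝 (n * (n + 1))) := by
    have := hV.tendsto_slope_zero_right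
    simpa [ratioVar] using this
  set Q : ℝ → ℝ := fun h => n ^ 4 * (Real.exp (12 * h) - 4 * Real.exp (6 * h) +
    6 * Real.exp (2 * h) - 3) with hQ
  have hQd : HasDerivAt Q 0 0 := by
    have h1 := ((((hE 12).sub ((hE 6).const_mul 4)).add ((hE 2).const_mul 6)).sub_const
      3).const_mul ((n : ℝ) ^ 4)
    exact h1.congr_deriv (by norm_num)
  have hB : Tendsto (fun h => h⁻¹ * Q h) (𝓝[>] 0) (𝓝 0) := by
    have := hQd.tendsto_slope_zero_right
    have hQ0 : Q 0 = 0 := by simp [hQ]; norm_num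
    simpa [hQ0] using this
  -- the interpolation parameter has to vanish, while `Q h / h` must be at most its square
  set l : ℝ → ℝ := fun h => √(h⁻¹ * Q h + h) with hl
  have hl0 : Tendsto l (𝓝[>] 0) (𝓝 0) := by
    have h1 : Tendsto (fun h : ℝ => h) (𝓝[>] 0) (𝓝 0) := nhdsWithin_le_nhds
    have := (Real.continuous_sqrt.tendsto _).comp (hB.add h1)
    simpa [hl, Function.comp_def] using this
  have hmain : Tendsto (fun h => h⁻¹ * ratioVar n h * (((n : ℝ) + 1) ^ 3)⁻¹) (𝓝[>] 0)
      (𝓝 (n / ((n : ℝ) + 1) ^ 2)) := by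
    have e : n * (n + 1) * (((n : ℝ) + 1) ^ 3)⁻¹ = n / ((n : ℝ) + 1) ^ 2 := by
      have : (n : ℝ) + 1 ≠ 0 := by positivity
      field_simp
    rw [← e]
    exact hA.mul_const _
  have herr : Tendsto (fun h => l h * (h⁻¹ * ratioVar n h) / 2 + l h / 2) (𝓝[>] 0) (𝓝 0) := by
    simpa using ((hl0.mul hA).div_const 2).add (hl0.div_const 2)
  refine tendsto_of_tendsto_of_dist hmain (squeeze_zero' (Eventually.of_forall fun _ =>
    dist_nonneg) ?_ herr)
  filter_upwards [self_mem_nhdsWithin] with h hh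
  have hh : 0 < h := hh
  have hQ0 : 0 ≤ Q h := (integral_nonneg fun w => by positivity).trans
    (integral_ratioSum_sub_pow_four (n := n) hh.le).2
  have hB0 : 0 ≤ h⁻¹ * Q h := by positivity
  have hlpos : 0 < l h := Real.sqrt_pos.2 (by linarith)
  have hlsq : h⁻¹ * Q h ≤ l h * l h := by
    rw [hl]; simp only
    rw [Real.mul_self_sqrt (by linarith)]
    linarith
  have key := abs_overlap_sub_le (n := n) hh.le hlpos
  rw [dist_comm, Real.dist_eq]
  have e : h⁻¹ * (overlap n h - ((n : ℝ) + 1)⁻¹) - h⁻¹ * ratioVar n h * (((n : ℝ) + 1) ^ 3)⁻¹ =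
      h⁻¹ * (overlap n h - ((n : ℝ) + 1)⁻¹ - ratioVar n h * (((n : ℝ) + 1) ^ 3)⁻¹) := by ring
  rw [e, abs_mul, abs_of_pos (inv_pos.2 hh)]
  refine (mul_le_mul_of_nonneg_left key (inv_pos.2 hh).le).trans ?_
  have h1 : h⁻¹ * Q h / l h ≤ l h := by rwa [div_le_iff₀ hlpos]
  have e2 : h⁻¹ * (l h * ratioVar n h / 2 + Q h / l h / 2) =
      l h * (h⁻¹ * ratioVar n h) / 2 + (h⁻¹ * Q h / l h) / 2 := by ring
  change h⁻¹ * (l h * ratioVar n h / 2 + Q h / l h / 2) ≤ _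
  rw [e2]
  linarith

/-- The integral in `stateFun`, over the pair `(u₁, (u₂, …, u_r))`, is the overlap. -/
lemma stateFun_succ (n : ℕ) (x : ℝ) : stateFun (n + 1) x =
    (1 / (n : ℝ)) * (((n : ℝ) + 1) * overlap n (x / ((n : ℝ) + 1)) - 1) := by
  have hmp := measurePreserving_piFinSuccAbove (fun _ : Fin (n + 1) => gaussianReal 0 1) 0
  have e : overlap n (x / ((n : ℝ) + 1)) = ∫ u : ℝ × (Fin n → ℝ),
      Real.exp (x / ((n : ℝ) + 1) + u.1 * √(x / ((n : ℝ) + 1))) /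
        (Real.exp (x / ((n : ℝ) + 1) + u.1 * √(x / ((n : ℝ) + 1))) +
          ∑ i, Real.exp (u.2 i * √(x / ((n : ℝ) + 1))))
      ∂((gaussianReal 0 1).prod (Measure.pi fun _ : Fin n => gaussianReal 0 1)) := by
    rw [← hmp.integral_comp', overlap]
    refine integral_congr_ae (ae_of_all _ fun w => ?_)
    set q := x / ((n : ℝ) + 1)
    have h1 : ratioSum n q w = (∑ i : Fin n, Real.exp (w i.succ * √q)) *
        (Real.exp (q + w 0 * √q))⁻¹ := by
      rw [ratioSum, Finset.sum_mul]
      refine Finset.sum_congr rfl fun i _ => ?_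
      rw [weight, ← Real.exp_neg, ← Real.exp_add]
      ring_nf
    have h2 := (Real.exp_pos (q + w 0 * √q))
    have h3 : 0 ≤ ∑ i : Fin n, Real.exp (w i.succ * √q) :=
      Finset.sum_nonneg fun i _ => (Real.exp_pos _).le
    have e0 : MeasurableEquiv.piFinSuccAbove (fun _ => ℝ) 0 w = (w 0, fun i => w i.succ) := rfl
    simp only [e0]
    rw [h1]
    field_simp
    simp_rw [mul_comm (√q)]
  rw [stateFun, e]
  push_cast
  rw [add_sub_cancel_right]
  rfl

end

/-! ### The replica free energy -/

section

variable {n : ℕ}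

/-- The all-ones matrix. -/
def allOnes (r : ℕ) : Matrix (Fin r) (Fin r) ℝ := Matrix.of fun _ _ => 1

lemma posSemidef_smul_one_add {r : ℕ} {a k : ℝ} (ha : 0 ≤ a) (hk : 0 ≤ k) :
    (a • (1 : Matrix (Fin r) (Fin r) ℝ) + k • allOnes r).PosSemidef := by
  have h1 : (allOnes r).PosSemidef := by
    have := Matrix.posSemidef_vecMulVec_self_star (fun _ : Fin r => (1 : ℝ))
    convert this
    ext i j; simp [allOnes, Matrix.vecMulVec]
  exact (Matrix.PosSemidef.one.smul ha).add (h1.smul hk)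

open scoped MatrixOrder in
/-- The square root of `q I + c J` is again of this form. -/
lemma sqrt_smul_one_add {r : ℕ} (hr : 0 < r) {q c : ℝ} (hq : 0 ≤ q) (hc : 0 ≤ c) :
    CFC.sqrt (q • (1 : Matrix (Fin r) (Fin r) ℝ) + c • allOnes r) =
      √q • (1 : Matrix (Fin r) (Fin r) ℝ) + ((√(q + r * c) - √q) / r) • allOnes r := by
  have hr' : (0 : ℝ) < r := Nat.cast_pos.2 hr
  have h1 := Real.mul_self_sqrt hq
  have h2 := Real.mul_self_sqrt (show 0 ≤ q + r * c by positivity)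
  have h3 : √q ≤ √(q + r * c) := Real.sqrt_le_sqrt (by nlinarith)
  have hJ : allOnes r * allOnes r = (r : ℝ) • allOnes r := by
    ext i j; simp [allOnes, Matrix.mul_apply]
  refine CFC.sqrt_unique ?_ (posSemidef_smul_one_add (Real.sqrt_nonneg q)
    (div_nonneg (sub_nonneg.2 h3) hr'.le)).nonneg
  rw [add_mul, mul_add, mul_add, smul_mul_smul_comm, smul_mul_smul_comm, smul_mul_smul_comm,
    smul_mul_smul_comm, mul_one, mul_one, one_mul, hJ, h1, add_assoc, smul_smul, ← add_smul,
    ← add_smul]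
  congr 2
  generalize √(q + r * c) = s at *
  generalize √q = t at *
  field_simp
  linarith

/-- A Gaussian vector with covariance `q I + c J` is `√q w` plus a multiple of `(∑ⱼ wⱼ) 1`, with `w`
standard. -/
lemma integral_multivariateGaussian {r : ℕ} (hr : 0 < r) {q c : ℝ} (hq : 0 ≤ q) (hc : 0 ≤ c)
    (m : Fin r → ℝ) {g : (Fin r → ℝ) → ℝ} (hg : Measurable g) :
    ∫ B : EuclideanSpace ℝ (Fin r), g B.ofLp ∂(multivariateGaussian (WithLp.toLp 2 m)
        (q • (1 : Matrix (Fin r) (Fin r) ℝ) + c • allOnes r)) =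
      ∫ w, g (fun i => m i + √q * w i + (√(q + r * c) - √q) / r * ∑ j, w j)
        ∂(stdNormal (Fin r)) := by
  rw [multivariateGaussian, sqrt_smul_one_add hr hq hc, ← map_pi_eq_stdGaussian,
    Measure.map_map (by fun_prop) (by fun_prop),
    integral_map (Measurable.aemeasurable (by fun_prop))
      (Measurable.aestronglyMeasurable (by fun_prop))]
  refine integral_congr_ae (ae_of_all _ fun w => ?_)
  simp only [Function.comp_apply]
  congr 1
  ext i
  simp only [WithLp.ofLp_add, Pi.add_apply, Matrix.ofLp_toEuclideanCLM, Matrix.add_mulVec,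
    Matrix.smul_mulVec, Matrix.one_mulVec, Pi.smul_apply, smul_eq_mul]
  simp [allOnes, Matrix.mulVec, dotProduct]
  ring

lemma measurePreserving_comp_perm {ι : Type*} [Fintype ι] (σ : Equiv.Perm ι) :
    MeasurePreserving (fun (w : ι → ℝ) i => w (σ i)) (stdNormal ι) (stdNormal ι) := by
  refine ⟨by fun_prop, (Measure.pi_eq fun s hs => ?_).symm⟩
  rw [Measure.map_apply (by fun_prop) (MeasurableSet.univ_pi hs)]
  have : (fun (w : ι → ℝ) i => w (σ i)) ⁻¹' (Set.univ.pi s) =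
      Set.univ.pi fun i => s (σ.symm i) := by
    ext w
    simp only [Set.mem_preimage, Set.mem_univ_pi]
    exact ⟨fun h i => by simpa using h (σ.symm i), fun h i => by simpa using h (σ i)⟩
  rw [this, Measure.pi_pi]
  exact σ.symm.prod_comp fun i => gaussianReal 0 1 (s i)

lemma integral_eval_stdNormal {ι : Type*} [Fintype ι] (i : ι) :
    Integrable (fun w : ι → ℝ => w i) (stdNormal ι) ∧ ∫ w, w i ∂(stdNormal ι) = 0 := by
  have hmp := measurePreserving_eval (fun _ : ι => gaussianReal 0 1) i
  have hid : Integrable (fun x : ℝ => x) (gaussianReal 0 1) :=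
    (memLp_id_gaussianReal 1).integrable le_rfl
  refine ⟨hmp.integrable_comp_of_integrable hid, ?_⟩
  have h2 := integral_map (μ := stdNormal ι) (φ := Function.eval i) (f := fun x : ℝ => x)
    (Measurable.aemeasurable (by fun_prop)) (by fun_prop)
  rw [hmp.map_eq] at h2
  exact h2.symm.trans (by simp)

/-- The logarithm of the partition function, with the weight of the true group `t` factored
out. -/
lemma log_partitionFun (q c : ℝ) (t : Fin (n + 1)) (w : Fin (n + 1) → ℝ) (k : ℝ) :
    Real.log (partitionFun (n + 1) (q • (1 : Matrix (Fin (n + 1)) (Fin (n + 1)) ℝ) +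
        c • allOnes (n + 1))
      (fun i => (q • (1 : Matrix (Fin (n + 1)) (Fin (n + 1)) ℝ) +
        c • allOnes (n + 1)).mulVec (Pi.single t 1) i + √q * w i + k)) =
      (c / 2 + q / 2 - Real.log ((n : ℝ) + 1)) + √q * w t + k +
        Real.log (1 + ratioSum n q fun i => w (Equiv.swap 0 t i)) := by
  set σ := Equiv.swap 0 t with hσ
  have hsum : partitionFun (n + 1) (q • (1 : Matrix (Fin (n + 1)) (Fin (n + 1)) ℝ) +
        c • allOnes (n + 1))
      (fun i => (q • (1 : Matrix (Fin (n + 1)) (Fin (n + 1)) ℝ) +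
        c • allOnes (n + 1)).mulVec (Pi.single t 1) i + √q * w i + k) =
      ((n : ℝ) + 1)⁻¹ * (Real.exp (c / 2 + q / 2 + √q * w t + k) *
        (1 + ratioSum n q fun i => w (σ i))) := by
    rw [partitionFun, ← Equiv.sum_comp σ, Fin.sum_univ_succ, mul_add (Real.exp _) 1, mul_one]
    have hσ0 : σ 0 = t := Equiv.swap_apply_left 0 t
    have hne : ∀ i : Fin n, σ i.succ ≠ t := fun i h => by
      rw [← hσ0] at h
      exact Fin.succ_ne_zero i (σ.injective h)
    rw [hσ0, ratioSum, Finset.mul_sum]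
    push_cast
    rw [one_div]
    congr 2
    · congr 1
      simp [allOnes, Matrix.mulVec, Matrix.one_apply]
      ring
    · refine Finset.sum_congr rfl fun i _ => ?_
      rw [weight, hσ0, ← Real.exp_add]
      congr 1
      simp [allOnes, Matrix.mulVec, Matrix.one_apply, hne i]
      ring
  have hR := ratioSum_nonneg q fun i => w (σ i)
  rw [hsum, Real.log_mul (by positivity) (by positivity), Real.log_mul (by positivity)
    (by positivity), Real.log_exp, Real.log_inv]
  ring

/-- The free energy at `M(b)`: the component of the noise along the all-ones vector only
contributes a term that is affine in `b`. -/
lemma freeEnergy_succ (n : ℕ) {Δ b : ℝ} (hΔ : 0 < Δ) (hb0 : 0 ≤ b) (hb1 : b ≤ 1) :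
    freeEnergy (n + 1) Δ b = b / Δ / ((n : ℝ) + 1) / 2 - Real.log ((n : ℝ) + 1) +
      logLoss n (b / Δ / ((n : ℝ) + 1)) + (1 - b) / (2 * ((n : ℝ) + 1) ^ 2 * Δ) -
      (1 + b ^ 2 * n) / (4 * ((n : ℝ) + 1) ^ 2 * Δ) := by
  have hn : (0 : ℝ) < (n : ℝ) + 1 := by positivity
  set q := b / Δ / ((n : ℝ) + 1) with hq
  set c := (1 - b) / (((n : ℝ) + 1) ^ 2 * Δ) with hc
  have hq0 : 0 ≤ q := by positivity
  have hc0 : 0 ≤ c := div_nonneg (by linarith) (by positivity)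
  have hA : Δ⁻¹ • orderParam (n + 1) b =
      q • (1 : Matrix (Fin (n + 1)) (Fin (n + 1)) ℝ) + c • allOnes (n + 1) := by
    rw [orderParam, smul_add, smul_smul, smul_smul]
    congr 2
    · rw [hq]; push_cast; field_simp
    · rw [hc]; push_cast; field_simp
  have htr : (orderParam (n + 1) b * (orderParam (n + 1) b).transpose).trace =
      (1 + b ^ 2 * n) / ((n : ℝ) + 1) ^ 2 := by
    have hT : (orderParam (n + 1) b).transpose = orderParam (n + 1) b := by
      ext i j
      simp [orderParam, Matrix.one_apply, eq_comm]
    have hJ : allOnes (n + 1) * allOnes (n + 1) = ((n : ℝ) + 1) • allOnes (n + 1) := by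
      ext i j; simp [allOnes, Matrix.mul_apply]
    have htrJ : (allOnes (n + 1)).trace = (n : ℝ) + 1 := by simp [allOnes, Matrix.trace]
    rw [hT]
    have e : orderParam (n + 1) b = (b / ((n : ℝ) + 1)) • 1 +
        ((1 - b) / ((n : ℝ) + 1) ^ 2) • allOnes (n + 1) := by
      rw [orderParam]; push_cast; rfl
    rw [e, add_mul, mul_add, mul_add, smul_mul_smul_comm, smul_mul_smul_comm, smul_mul_smul_comm,
      smul_mul_smul_comm, hJ]
    simp only [mul_one, one_mul, Matrix.trace_add, Matrix.trace_smul, htrJ, Matrix.trace_one,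
      Fintype.card_fin, smul_eq_mul]
    push_cast
    field_simp
    ring
  have hint : ∀ t : Fin (n + 1),
      ∫ B : EuclideanSpace ℝ (Fin (n + 1)),
        Real.log (partitionFun (n + 1) (Δ⁻¹ • orderParam (n + 1) b) B.ofLp)
        ∂(multivariateGaussian (WithLp.toLp 2
          ((Δ⁻¹ • orderParam (n + 1) b).mulVec (Pi.single t 1))) (Δ⁻¹ • orderParam (n + 1) b)) =
      c / 2 + q / 2 - Real.log ((n : ℝ) + 1) + logLoss n q := by
    intro t
    have hm : Measurable fun B => Real.log (partitionFun (n + 1)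
        (q • (1 : Matrix (Fin (n + 1)) (Fin (n + 1)) ℝ) + c • allOnes (n + 1)) B) := by
      refine Real.measurable_log.comp ?_
      unfold partitionFun
      simp only [dotProduct_single, mul_one]
      fun_prop
    rw [hA, integral_multivariateGaussian n.succ_pos hq0 hc0 _ hm]
    simp_rw [log_partitionFun]
    set κ := (√(q + ((n + 1 : ℕ) : ℝ) * c) - √q) / ((n + 1 : ℕ) : ℝ)
    have hW := fun i : Fin (n + 1) => integral_eval_stdNormal i
    have i1 : Integrable (fun w : Fin (n + 1) → ℝ => √q * w t) (stdNormal (Fin (n + 1))) :=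
      (hW t).1.const_mul _
    have i2 : Integrable (fun w : Fin (n + 1) → ℝ => κ * ∑ j, w j) (stdNormal (Fin (n + 1))) :=
      (integrable_finsetSum _ fun j _ => (hW j).1).const_mul _
    have hmp := measurePreserving_comp_perm (Equiv.swap 0 t)
    have i3 : Integrable (fun w : Fin (n + 1) → ℝ =>
        Real.log (1 + ratioSum n q fun i => w (Equiv.swap 0 t i))) (stdNormal (Fin (n + 1))) :=
      hmp.integrable_comp_of_integrable (integrable_log_ratioSum hq0)
    have e3 : ∫ w : Fin (n + 1) → ℝ, Real.log (1 + ratioSum n q fun i => w (Equiv.swap 0 t i))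
        ∂(stdNormal (Fin (n + 1))) = logLoss n q := by
      have := integral_map (μ := stdNormal (Fin (n + 1)))
        (φ := fun (w : Fin (n + 1) → ℝ) i => w (Equiv.swap 0 t i))
        (f := fun w => Real.log (1 + ratioSum n q w)) hmp.measurable.aemeasurable
        (by rw [hmp.map_eq]; exact (integrable_log_ratioSum hq0).1)
      rw [hmp.map_eq] at this
      exact this.symm
    have i4 : Integrable (fun w : Fin (n + 1) → ℝ =>
        (c / 2 + q / 2 - Real.log ((n : ℝ) + 1)) + √q * w t) (stdNormal (Fin (n + 1))) :=
      (integrable_const _).add i1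
    have i5 : Integrable (fun w : Fin (n + 1) → ℝ =>
        (c / 2 + q / 2 - Real.log ((n : ℝ) + 1)) + √q * w t + κ * ∑ j, w j)
        (stdNormal (Fin (n + 1))) := i4.add i2
    rw [integral_add i5 i3, integral_add i4 i2, integral_add (integrable_const _) i1,
      integral_const_mul, integral_const_mul, integral_finsetSum _ fun j _ => (hW j).1, e3]
    simp_rw [(hW _).2]
    simp
  rw [freeEnergy, replicaFreeEnergy, htr]
  simp_rw [hint]
  rw [Finset.sum_const, Finset.card_univ, Fintype.card_fin, nsmul_eq_mul, hc]
  push_cast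
  field_simp
  ring

end

/-! ### The state evolution function -/

section

variable {r : ℕ}

lemma stateFun_eq (hr : 2 ≤ r) (x : ℝ) :
    stateFun r x = (r * overlap (r - 1) (x / r) - 1) / ((r : ℝ) - 1) := by
  obtain ⟨n, rfl⟩ : ∃ n, r = n + 1 := ⟨r - 1, by omega⟩
  rw [stateFun_succ, Nat.add_sub_cancel]
  push_cast
  rw [add_sub_cancel_right]
  ring

lemma one_sub_stateFun_eq (hr : 2 ≤ r) (x : ℝ) :
    1 - stateFun r x = r / ((r : ℝ) - 1) * (1 - overlap (r - 1) (x / r)) := by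
  have : (2 : ℝ) ≤ r := by exact_mod_cast hr
  have h1 : (r : ℝ) - 1 ≠ 0 := by linarith
  rw [stateFun_eq hr]
  field_simp
  ring

lemma stateFun_zero (hr : 2 ≤ r) : stateFun r 0 = 0 := by
  have : (2 : ℝ) ≤ r := by exact_mod_cast hr
  rw [stateFun_eq hr, zero_div, overlap_zero, Nat.cast_sub (by omega)]
  simp
  left
  rw [mul_inv_cancel₀ (by linarith), sub_self]

lemma stateFun_monotoneOn (hr : 2 ≤ r) : MonotoneOn (stateFun r) (Set.Ici 0) := by
  have h2 : (2 : ℝ) ≤ r := by exact_mod_cast hr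
  intro x hx y hy hxy
  rw [Set.mem_Ici] at hx hy
  have := overlap_monotoneOn (r - 1) (Set.mem_Ici.2 (show 0 ≤ x / (r : ℝ) by positivity))
    (Set.mem_Ici.2 (show 0 ≤ y / (r : ℝ) by positivity)) (by gcongr)
  rw [stateFun_eq hr, stateFun_eq hr]
  gcongr
  linarith

lemma stateFun_nonneg (hr : 2 ≤ r) {x : ℝ} (hx : 0 ≤ x) : 0 ≤ stateFun r x := by
  rw [← stateFun_zero hr]
  exact stateFun_monotoneOn hr (Set.mem_Ici.2 le_rfl) hx hx

lemma stateFun_le_one (hr : 2 ≤ r) (x : ℝ) : stateFun r x ≤ 1 := by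
  have h2 : (2 : ℝ) ≤ r := by exact_mod_cast hr
  have h3 := one_sub_stateFun_eq hr x
  have h4 := overlap_le_one (r - 1) (x / r)
  have : 0 ≤ (r : ℝ) / (r - 1) * (1 - overlap (r - 1) (x / r)) :=
    mul_nonneg (div_nonneg (by linarith) (by linarith)) (by linarith)
  linarith

lemma stateFun_continuousOn (hr : 2 ≤ r) : ContinuousOn (stateFun r) (Set.Ici 0) := by
  have h1 : ContinuousOn (fun x : ℝ => overlap (r - 1) (x / r)) (Set.Ici 0) :=
    (continuousOn_overlap (r - 1)).comp (by fun_prop) fun x hx =>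
      div_nonneg (Set.mem_Ici.1 hx) (Nat.cast_nonneg r)
  exact (((h1.const_smul (r : ℝ)).sub (continuousOn_const (c := 1))).div_const ((r : ℝ) - 1)).congr
    fun x _ => by simp [stateFun_eq hr]

lemma stateFun_le_exp (hr : 2 ≤ r) {x : ℝ} (hx : 0 ≤ x) :
    stateFun r x ≤ (Real.exp (2 * (x / r)) - 1) / r := by
  obtain ⟨n, rfl⟩ : ∃ n, r = n + 1 := ⟨r - 1, by omega⟩
  have hn : (1 : ℝ) ≤ n := by exact_mod_cast (show 1 ≤ n by omega)
  have h1 := overlap_le_exp (n := n) (q := x / ((n : ℝ) + 1)) (by positivity)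
  have hE : 0 ≤ Real.exp (2 * (x / ((n : ℝ) + 1))) - 1 := by
    have := Real.one_le_exp (show 0 ≤ 2 * (x / ((n : ℝ) + 1)) by positivity); linarith
  rw [stateFun_succ]
  push_cast
  calc 1 / (n : ℝ) * (((n : ℝ) + 1) * overlap n (x / ((n : ℝ) + 1)) - 1)
      ≤ 1 / (n : ℝ) * (((n : ℝ) + 1) * ((1 + n * Real.exp (2 * (x / ((n : ℝ) + 1)))) /
          ((n : ℝ) + 1) ^ 2) - 1) := by gcongr
    _ = _ := by field_simp; ring

lemma one_sub_stateFun_le (hr : 2 ≤ r) {x : ℝ} (hx : 0 ≤ x) {θ : ℝ} (h0 : 0 ≤ θ) (h1 : θ ≤ 1) :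
    1 - stateFun r x ≤ 4 * Real.exp (θ * Real.log r - θ * (1 - θ) * (x / r) / 2) := by
  have h2 : (2 : ℝ) ≤ r := by exact_mod_cast hr
  have h3 := one_sub_overlap_le (n := r - 1) (by omega) (show 0 ≤ x / (r : ℝ) by positivity) h0 h1
  have h4 : (r : ℝ) / (r - 1) ≤ 2 := by
    rw [div_le_iff₀ (by linarith)]; linarith
  have h5 : Real.log ((r - 1 : ℕ) : ℝ) ≤ Real.log r :=
    Real.log_le_log (by exact_mod_cast (show 0 < r - 1 by omega)) (by exact_mod_cast Nat.sub_le r 1)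
  have h6 := overlap_le_one (r - 1) (x / r)
  rw [one_sub_stateFun_eq hr]
  calc _ ≤ 2 * (1 - overlap (r - 1) (x / r)) := mul_le_mul_of_nonneg_right h4 (by linarith)
    _ ≤ 2 * (2 * Real.exp (θ * Real.log ((r - 1 : ℕ) : ℝ) - θ * (1 - θ) * (x / r) / 2)) := by
        gcongr
    _ ≤ 2 * (2 * Real.exp (θ * Real.log r - θ * (1 - θ) * (x / r) / 2)) := by gcongr
    _ = _ := by ring

/-- `overlap_add_le` in terms of the state evolution function. -/
lemma stateFun_sub_le (hr : 2 ≤ r) {x y : ℝ} (hx : 0 ≤ x) (hxy : x ≤ y) :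
    stateFun r y - stateFun r x ≤ (Real.exp (2 * ((y - x) / r)) - 1) * (1 - stateFun r x) := by
  have h2 : (2 : ℝ) ≤ r := by exact_mod_cast hr
  have h3 := overlap_add_le (n := r - 1) (show 0 ≤ x / (r : ℝ) by positivity)
    (show 0 ≤ (y - x) / (r : ℝ) from div_nonneg (by linarith) (by linarith))
  rw [← add_div, add_sub_cancel] at h3
  have e : stateFun r y - stateFun r x = r / ((r : ℝ) - 1) *
      (overlap (r - 1) (y / r) - overlap (r - 1) (x / r)) := by
    have := one_sub_stateFun_eq hr x
    have := one_sub_stateFun_eq hr y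
    linarith
  rw [e, one_sub_stateFun_eq hr, mul_left_comm]
  refine mul_le_mul_of_nonneg_left (by linarith) (div_nonneg (by linarith) (by linarith))

/-- The slope of the state evolution function at the origin is `1 / r²`. -/
lemma tendsto_stateFun_div (hr : 2 ≤ r) :
    Tendsto (fun x => stateFun r x / x) (𝓝[>] 0) (𝓝 (1 / (r : ℝ) ^ 2)) := by
  obtain ⟨n, rfl⟩ : ∃ n, r = n + 1 := ⟨r - 1, by omega⟩
  have hn : (n : ℝ) ≠ 0 := by
    have : n ≠ 0 := by omega
    exact_mod_cast this
  have hn1 : (0 : ℝ) < (n : ℝ) + 1 := by positivity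
  have hs : Tendsto (fun x : ℝ => x / ((n : ℝ) + 1)) (𝓝[>] 0) (𝓝[>] 0) := by
    refine tendsto_nhdsWithin_iff.2 ⟨?_, ?_⟩
    · have : Continuous fun x : ℝ => x / ((n : ℝ) + 1) := by fun_prop
      simpa using (this.tendsto 0).mono_left nhdsWithin_le_nhds
    · filter_upwards [self_mem_nhdsWithin] with x hx
      exact div_pos hx hn1
  have h1 := ((tendsto_overlap_slope n).comp hs).const_mul (1 / (n : ℝ))
  have e : 1 / (n : ℝ) * (n / ((n : ℝ) + 1) ^ 2) = 1 / (((n + 1 : ℕ) : ℝ)) ^ 2 := by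
    push_cast; field_simp
  rw [e] at h1
  refine h1.congr' ?_
  filter_upwards [self_mem_nhdsWithin] with x hx
  have hx : x ≠ 0 := ne_of_gt hx
  simp only [Function.comp_apply]
  rw [stateFun_succ]
  field_simp

/-! ### State evolution as a dynamical system -/

variable {Δ : ℝ}

lemma stateEvolution_monotoneOn (hr : 2 ≤ r) (hΔ : 0 < Δ) :
    MonotoneOn (stateEvolution r Δ) (Set.Ici 0) := fun x hx y hy hxy =>
  stateFun_monotoneOn hr (div_nonneg hx hΔ.le) (div_nonneg hy hΔ.le) (by gcongr)

lemma iterate_stateEvolution_nonneg (hr : 2 ≤ r) (hΔ : 0 < Δ) {b : ℝ} (hb : 0 ≤ b) (t : ℕ) :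
    0 ≤ (stateEvolution r Δ)^[t] b := by
  induction t with
  | zero => exact hb
  | succ t ih =>
    rw [Function.iterate_succ_apply']
    exact stateFun_nonneg hr (div_nonneg ih hΔ.le)

/-- A point that moves up bounds its whole orbit, and that of every larger point, from below. -/
lemma le_iterate_stateEvolution (hr : 2 ≤ r) (hΔ : 0 < Δ) {a b : ℝ} (ha : 0 ≤ a)
    (hle : a ≤ stateEvolution r Δ a) (hab : a ≤ b) (t : ℕ) : a ≤ (stateEvolution r Δ)^[t] b := by
  induction t with
  | zero => exact hab
  | succ t ih =>
    rw [Function.iterate_succ_apply']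
    exact hle.trans (stateEvolution_monotoneOn hr hΔ ha (ha.trans ih) ih)

/-- State evolution started from `1` decreases to the largest fixed point. -/
lemma exists_isInformative (hr : 2 ≤ r) (hΔ : 0 < Δ) :
    ∃ b, 0 ≤ b ∧ b ≤ 1 ∧ IsInformative r Δ b ∧ stateEvolution r Δ b = b ∧
      ∀ a, 0 ≤ a → stateEvolution r Δ a = a → a ≤ b := by
  set g := stateEvolution r Δ with hg
  have hpos : ∀ t, 0 ≤ g^[t] 1 := iterate_stateEvolution_nonneg hr hΔ zero_le_one
  have hstep : ∀ t, g^[t + 1] 1 ≤ g^[t] 1 := by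
    intro t
    induction t with
    | zero =>
      rw [zero_add, Function.iterate_one, Function.iterate_zero, id]
      exact stateFun_le_one hr (1 / Δ)
    | succ t ih =>
      have h1 := stateEvolution_monotoneOn hr hΔ (hpos (t + 1)) (hpos t) ih
      rwa [← hg, ← Function.iterate_succ_apply' g, ← Function.iterate_succ_apply' g] at h1
  have hanti : Antitone fun t => g^[t] 1 := antitone_nat_of_succ_le hstep
  have hlim := tendsto_atTop_ciInf hanti ⟨0, by rintro _ ⟨t, rfl⟩; exact hpos t⟩
  set b := ⨅ t, g^[t] 1 with hb
  have hb0 : 0 ≤ b := ge_of_tendsto' hlim hpos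
  have hb1 : b ≤ 1 := le_of_tendsto' hlim fun t => hanti (Nat.zero_le t)
  refine ⟨b, hb0, hb1, hlim, ?_, fun a ha hga => ?_⟩
  · have hw : Tendsto (fun t => g^[t] 1 / Δ) atTop (𝓝[Set.Ici 0] (b / Δ)) :=
      tendsto_nhdsWithin_iff.2 ⟨hlim.div_const Δ, Eventually.of_forall fun t =>
        div_nonneg (hpos t) hΔ.le⟩
    have h1 : Tendsto (fun t => g^[t + 1] 1) atTop (𝓝 (g b)) := by
      simp_rw [Function.iterate_succ_apply']
      exact (stateFun_continuousOn hr (b / Δ) (div_nonneg hb0 hΔ.le)).tendsto.comp hw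
    exact tendsto_nhds_unique h1 (hlim.comp (tendsto_add_atTop_nat 1))
  · refine ge_of_tendsto' hlim (le_iterate_stateEvolution hr hΔ ha hga.ge ?_)
    rw [← hga]
    exact stateFun_le_one hr (a / Δ)

lemma uniformStable_of_lt (hr : 2 ≤ r) (hΔ : 1 / (r : ℝ) ^ 2 < Δ) : UniformStable r Δ := by
  have hΔ0 : 0 < Δ := lt_of_le_of_lt (by positivity) hΔ
  obtain ⟨c, hc1, hc2⟩ := exists_between hΔ
  have hc0 : 0 < c := lt_of_le_of_lt (by positivity) hc1
  have hev := (tendsto_stateFun_div hr).eventually_lt_const hc1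
  obtain ⟨δ, hδ, hsub⟩ := mem_nhdsGT_iff_exists_Ioo_subset.1 hev
  have hδ : 0 < δ := hδ
  have hcontr : ∀ b, 0 ≤ b → b < δ * Δ → stateEvolution r Δ b ≤ c / Δ * b := by
    intro b hb hbδ
    rcases hb.eq_or_lt with rfl | hb
    · rw [stateEvolution, zero_div, stateFun_zero hr, mul_zero]
    · have h1 : stateFun r (b / Δ) / (b / Δ) < c :=
        hsub ⟨div_pos hb hΔ0, (div_lt_iff₀ hΔ0).2 hbδ⟩
      rw [div_lt_iff₀ (div_pos hb hΔ0)] at h1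
      rw [stateEvolution]
      exact h1.le.trans_eq (by ring)
  have hρ : c / Δ < 1 := (div_lt_one hΔ0).2 hc2
  have hmem : Set.Ico 0 (δ * Δ) ∈ 𝓝[≥] (0 : ℝ) := Ico_mem_nhdsGE (by positivity)
  filter_upwards [hmem] with b hb
  have hit : ∀ t : ℕ, (stateEvolution r Δ)^[t] b ≤ (c / Δ) ^ t * b := by
    intro t
    induction t with
    | zero => simp
    | succ t ih =>
      rw [Function.iterate_succ_apply']
      have h0 := iterate_stateEvolution_nonneg hr hΔ0 hb.1 t
      have hle : (c / Δ) ^ t * b ≤ b :=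
        mul_le_of_le_one_left hb.1 (pow_le_one₀ (by positivity) hρ.le)
      refine (hcontr _ h0 (lt_of_le_of_lt (ih.trans hle) hb.2)).trans ?_
      rw [pow_succ', mul_assoc]
      gcongr
  refine squeeze_zero (iterate_stateEvolution_nonneg hr hΔ0 hb.1) hit ?_
  have := (tendsto_pow_atTop_nhds_zero_of_lt_one (by positivity) hρ).mul_const b
  simpa using this

lemma not_uniformStable_of_lt (hr : 2 ≤ r) (hΔ0 : 0 < Δ) (hΔ : Δ < 1 / (r : ℝ) ^ 2) :
    ¬ UniformStable r Δ := by
  intro hst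
  have hev := (tendsto_stateFun_div hr).eventually_const_lt hΔ
  have hs : Tendsto (fun b : ℝ => b / Δ) (𝓝[>] 0) (𝓝[>] 0) := by
    refine tendsto_nhdsWithin_iff.2 ⟨?_, ?_⟩
    · have : Continuous fun x : ℝ => x / Δ := by fun_prop
      simpa using (this.tendsto 0).mono_left nhdsWithin_le_nhds
    · filter_upwards [self_mem_nhdsWithin] with x hx
      exact div_pos hx hΔ0
  have hst' : ∀ᶠ b in 𝓝[>] (0 : ℝ),
      Tendsto (fun t : ℕ => (stateEvolution r Δ)^[t] b) atTop (𝓝 0) :=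
    hst.filter_mono (nhdsWithin_mono _ Set.Ioi_subset_Ici_self)
  obtain ⟨b, ⟨hb1, hb2⟩, hb3⟩ :=
    ((hs.eventually hev).and hst' |>.and self_mem_nhdsWithin).exists
  have hb3 : 0 < b := hb3
  rw [lt_div_iff₀ (div_pos hb3 hΔ0), mul_div_cancel₀ _ hΔ0.ne'] at hb1
  have := ge_of_tendsto' hb2 (le_iterate_stateEvolution hr hΔ0 hb3.le hb1.le le_rfl)
  linarith

lemma isUninformative_zero (hr : 2 ≤ r) (hΔ : 1 / (r : ℝ) ^ 2 < Δ) : IsUninformative r Δ 0 :=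
  (uniformStable_of_lt hr hΔ).filter_mono (nhdsWithin_mono _ Set.Ioi_subset_Ici_self)

lemma deltaC_eq (hr : 2 ≤ r) : deltaC r = 1 / (r : ℝ) ^ 2 := by
  have h2 : (0 : ℝ) < r := by exact_mod_cast (by omega : 0 < r)
  have hlb : ∀ Δ ∈ {Δ : ℝ | 0 < Δ ∧ UniformStable r Δ}, 1 / (r : ℝ) ^ 2 ≤ Δ := fun Δ hΔ => by
    by_contra! h
    exact not_uniformStable_of_lt hr hΔ.1 h hΔ.2
  have hmem : ∀ Δ : ℝ, 1 / (r : ℝ) ^ 2 < Δ → Δ ∈ {Δ : ℝ | 0 < Δ ∧ UniformStable r Δ} :=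
    fun Δ hΔ => ⟨lt_trans (by positivity) hΔ, uniformStable_of_lt hr hΔ⟩
  refine le_antisymm (le_of_forall_gt_imp_ge_of_dense fun Δ hΔ => ?_) ?_
  · exact csInf_le ⟨_, hlb⟩ (hmem Δ hΔ)
  · exact le_csInf ⟨_, hmem (1 / (r : ℝ) ^ 2 + 1) (by linarith)⟩ hlb

end

/-! ### Large-rank asymptotics of the state evolution function -/

section

variable {r : ℕ}

lemma tendsto_log_natCast : Tendsto (fun r : ℕ => Real.log r) atTop atTop :=
  Real.tendsto_log_atTop.comp tendsto_natCast_atTop_atTop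

lemma mul_log_div (hr : 2 ≤ r) (β : ℝ) : β * r * Real.log r / r = β * Real.log r := by
  have : (r : ℝ) ≠ 0 := by exact_mod_cast (by omega : r ≠ 0)
  field_simp

/-- Above `2 r log r` the state evolution function tends to one. -/
lemma tendsto_stateFun_of_two_lt {β : ℝ} (hβ : 2 < β) :
    Tendsto (fun r : ℕ => stateFun r (β * r * Real.log r)) atTop (𝓝 1) := by
  -- any `θ < 1 - 2 / β` makes the exponent in `one_sub_stateFun_le` negative
  set θ := (1 - 2 / β) / 2 with hθ
  have hβ0 : 0 < β := by linarith
  have h2β : 2 / β < 1 := (div_lt_one hβ0).2 hβ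
  have h2β0 : 0 < 2 / β := by positivity
  have hc : 0 < θ * ((1 - θ) * β / 2 - 1) := by
    have e : (1 - θ) * β / 2 - 1 = (β - 2) / 4 := by rw [hθ]; field_simp; ring
    rw [e]
    exact mul_pos (by rw [hθ]; linarith) (by linarith)
  have hlim : Tendsto (fun r : ℕ => 1 - 4 * Real.exp (-(θ * ((1 - θ) * β / 2 - 1) * Real.log r)))
      atTop (𝓝 1) := by
    have h1 := Real.tendsto_exp_neg_atTop_nhds_zero.comp (tendsto_log_natCast.const_mul_atTop hc)
    simpa using (h1.const_mul 4).const_sub 1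
  refine tendsto_of_tendsto_of_tendsto_of_le_of_le' hlim tendsto_const_nhds ?_ ?_
  · filter_upwards [eventually_ge_atTop 2] with r hr
    have hlog : 0 ≤ Real.log r := Real.log_natCast_nonneg r
    have h1 := one_sub_stateFun_le hr (x := β * r * Real.log r) (by positivity) (θ := θ)
      (by rw [hθ]; linarith) (by rw [hθ]; linarith)
    rw [mul_log_div hr, show θ * Real.log r - θ * (1 - θ) * (β * Real.log r) / 2 =
      -(θ * ((1 - θ) * β / 2 - 1) * Real.log r) by ring] at h1
    linarith
  · filter_upwards [eventually_ge_atTop 2] with r hr using stateFun_le_one hr _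

/-- Below `2 r log r` the largest of the wrong groups, of size `√(2 log r)`, hides the true one. -/
lemma tendsto_overlap_zero {σ : ℝ} (h0 : 0 < σ) (h1 : σ < 1) :
    Tendsto (fun r : ℕ => overlap (r - 1) (2 * σ ^ 2 * Real.log r)) atTop (𝓝 0) := by
  set s := (1 + σ) / 2 with hs
  set θ := (1 - σ) / 2 with hθ
  have hs0 : 0 < s := by rw [hs]; linarith
  have hs1 : s < 1 := by rw [hs]; linarith
  set C := (√(2 * Real.pi))⁻¹ with hC
  have hC0 : 0 < C := by positivity
  have hsqrt : Tendsto (fun r : ℕ => √(Real.log r)) atTop atTop :=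
    Real.tendsto_sqrt_atTop.comp tendsto_log_natCast
  have hlim1 : Tendsto (fun r : ℕ => Real.exp (-(C / 2 * Real.exp (√(Real.log r) *
      ((1 - s ^ 2) * √(Real.log r) - √2 * s) - 1 / 2)))) atTop (𝓝 0) := by
    have hpos : 0 < 1 - s ^ 2 := by nlinarith
    have l1 : Tendsto (fun l : ℝ => l * ((1 - s ^ 2) * l - √2 * s) - 1 / 2) atTop atTop :=
      tendsto_atTop_add_const_right _ _ (tendsto_id.atTop_mul_atTop₀
        (tendsto_atTop_add_const_right _ _ (tendsto_id.const_mul_atTop hpos)))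
    exact Real.tendsto_exp_neg_atTop_nhds_zero.comp
      ((Real.tendsto_exp_atTop.comp (l1.comp hsqrt)).const_mul_atTop (by positivity))
  have hc : 0 < θ * (σ * (1 - σ) - θ * σ ^ 2) := by
    have e : σ * (1 - σ) - θ * σ ^ 2 = σ * (1 - σ) * (1 - σ / 2) := by rw [hθ]; ring
    rw [e]
    have : 0 < 1 - σ := by linarith
    have : 0 < 1 - σ / 2 := by linarith
    positivity
  have hlim2 : Tendsto (fun r : ℕ => Real.exp (-(θ * (σ * (1 - σ) - θ * σ ^ 2) * Real.log r)))
      atTop (𝓝 0) :=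
    Real.tendsto_exp_neg_atTop_nhds_zero.comp (tendsto_log_natCast.const_mul_atTop hc)
  have hlim := hlim1.add hlim2
  rw [add_zero] at hlim
  refine squeeze_zero' (Eventually.of_forall fun r => overlap_nonneg _ _) ?_ hlim
  filter_upwards [eventually_ge_atTop 2] with r hr
  have hr2 : (2 : ℝ) ≤ r := by exact_mod_cast hr
  have hlog : 0 ≤ Real.log r := Real.log_natCast_nonneg r
  set l := √(Real.log r) with hl
  have hll : l ^ 2 = Real.log r := Real.sq_sqrt hlog
  have hl0 : 0 ≤ l := Real.sqrt_nonneg _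
  have h2 : √2 * √2 = 2 := Real.mul_self_sqrt (by norm_num)
  have hsq : √(2 * σ ^ 2 * Real.log r) = √2 * σ * l := by
    rw [← hll, Real.sqrt_eq_iff_mul_self_eq (by positivity) (by positivity)]
    linear_combination (-(σ ^ 2 * l ^ 2)) * h2
  have hb := overlap_le_pow_add_exp (n := r - 1) (q := 2 * σ ^ 2 * Real.log r) (by positivity)
    (s * √2 * l) (θ := θ) (by rw [hθ]; linarith) (by rw [hθ]; linarith)
  refine hb.trans (add_le_add ?_ (le_of_eq ?_))
  · have hp := gaussianReal_real_Ioi_ge (show 0 ≤ s * √2 * l by positivity)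
    have hcompl : (gaussianReal 0 1).real (Set.Iic (s * √2 * l)) =
        1 - (gaussianReal 0 1).real (Set.Ioi (s * √2 * l)) := by
      rw [← Set.compl_Ioi, probReal_compl_eq_one_sub measurableSet_Ioi]
    set p := (gaussianReal 0 1).real (Set.Ioi (s * √2 * l)) with hp'
    have h3 : (gaussianReal 0 1).real (Set.Iic (s * √2 * l)) ≤ Real.exp (-p) := by
      rw [hcompl]; linarith [Real.add_one_le_exp (-p)]
    refine (pow_le_pow_left₀ measureReal_nonneg h3 _).trans ?_
    rw [← Real.exp_nat_mul]
    refine Real.exp_le_exp.2 ?_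
    have h4 : ((r - 1 : ℕ) : ℝ) = r - 1 := by rw [Nat.cast_sub (by omega)]; simp
    have h5 : C / 2 * Real.exp (l * ((1 - s ^ 2) * l - √2 * s) - 1 / 2) =
        r / 2 * (C * Real.exp (-(s * √2 * l + 1) ^ 2 / 2)) := by
      have e : l * ((1 - s ^ 2) * l - √2 * s) - 1 / 2 =
          Real.log r + -(s * √2 * l + 1) ^ 2 / 2 := by
        rw [← hll]
        linear_combination (s ^ 2 * l ^ 2 / 2) * h2
      rw [e, Real.exp_add, Real.exp_log (by linarith)]
      ring
    have h6 : (r : ℝ) / 2 * (C * Real.exp (-(s * √2 * l + 1) ^ 2 / 2)) ≤ ((r - 1 : ℕ) : ℝ) * p := by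
      rw [h4]
      exact mul_le_mul (by linarith) hp (by positivity) (by linarith)
    rw [h5]
    linarith
  · congr 1
    rw [hsq, ← hll, hs]
    rw [show θ = (1 - σ) / 2 from hθ]
    linear_combination (-(1 - σ) / 2 * σ * (1 + σ) / 2 * l ^ 2) * h2

lemma tendsto_stateFun_of_lt_two {β : ℝ} (hβ0 : 0 ≤ β) (hβ : β < 2) :
    Tendsto (fun r : ℕ => stateFun r (β * r * Real.log r)) atTop (𝓝 0) := by
  -- by monotonicity, `β` may be replaced by some `2 σ² ≥ β` with `0 < σ < 1`
  set σ := √((β + 2) / 4) with hσ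
  have hσ2 : σ ^ 2 = (β + 2) / 4 := Real.sq_sqrt (by linarith)
  have hσ0 : 0 < σ := Real.sqrt_pos.2 (by linarith)
  have hσ1 : σ < 1 := by nlinarith
  have hlim := (tendsto_overlap_zero hσ0 hσ1).const_mul 2
  rw [mul_zero] at hlim
  refine squeeze_zero' ?_ ?_ hlim
  · filter_upwards [eventually_ge_atTop 2] with r hr
    have hlog : 0 ≤ Real.log r := Real.log_natCast_nonneg r
    exact stateFun_nonneg hr (by positivity)
  · filter_upwards [eventually_ge_atTop 2] with r hr
    have hlog : 0 ≤ Real.log r := Real.log_natCast_nonneg r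
    have hr2 : (2 : ℝ) ≤ r := by exact_mod_cast hr
    have h1 := overlap_monotoneOn (r - 1) (Set.mem_Ici.2 (show 0 ≤ β * Real.log r by positivity))
      (Set.mem_Ici.2 (show 0 ≤ 2 * σ ^ 2 * Real.log r by positivity))
      (mul_le_mul_of_nonneg_right (by rw [hσ2]; linarith) hlog)
    have h2 := overlap_nonneg (r - 1) (β * Real.log r)
    have h3 := overlap_le_one (r - 1) (β * Real.log r)
    rw [stateFun_eq hr, mul_log_div hr, div_le_iff₀ (by linarith)]
    nlinarith

/-- Up to `β r log r`, with `β < 2`, the state evolution function lies below any line of slope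
`c / (r log r)`: there are no fixed points in this range when the noise is of that order. -/
lemma eventually_le_of_le_stateFun {β c : ℝ} (hβ : β < 2) (hc : 0 < c) :
    ∀ᶠ r : ℕ in atTop, ∀ x : ℝ, 0 < x → c * x / (r * Real.log r) ≤ stateFun r x →
      β * (r * Real.log r) ≤ x := by
  have hβ' : max β 1 < 2 := max_lt hβ (by norm_num)
  have ev1 := (tendsto_stateFun_of_lt_two (le_trans zero_le_one (le_max_right β 1))
    hβ').eventually_lt_const (show (0 : ℝ) < c / 4 by positivity)
  have lim2 : Tendsto (fun r : ℕ => 2 * (Real.log r * Real.exp (-(1 / 2) * Real.log r))) atTop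
      (𝓝 0) := by
    have h1 := (tendsto_rpow_mul_exp_neg_mul_atTop_nhds_zero 1 (1 / 2) (by norm_num)).comp
      tendsto_log_natCast
    simpa using h1.const_mul 2
  filter_upwards [ev1, lim2.eventually_lt_const hc, eventually_ge_atTop 2,
    tendsto_log_natCast.eventually_gt_atTop 0] with r h1 h2 hr hlog x hx hle
  have hr2 : (2 : ℝ) ≤ r := by exact_mod_cast hr
  have hr0 : (0 : ℝ) < r := by linarith
  by_contra! hlt
  rw [div_le_iff₀ (by positivity)] at hle
  rcases le_total x (1 / 4 * (r * Real.log r)) with hsmall | hbig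
  · have h3 := stateFun_le_exp hr hx.le
    have hq : x / r ≤ Real.log r / 4 := by
      rw [div_le_iff₀ hr0]; linarith
    have h4 : Real.exp (2 * (x / r)) - 1 ≤ 2 * (x / r) * Real.exp (Real.log r / 2) := by
      have h5 := Real.add_one_le_exp (-(2 * (x / r)))
      have h6 : Real.exp (2 * (x / r)) * Real.exp (-(2 * (x / r))) = 1 := by
        rw [← Real.exp_add]; simp
      have h7 : Real.exp (2 * (x / r)) ≤ Real.exp (Real.log r / 2) :=
        Real.exp_le_exp.2 (by linarith)
      have h8 : 0 ≤ 2 * (x / r) := by positivity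
      have h9 := Real.exp_pos (2 * (x / r))
      nlinarith
    have h5 : Real.exp (Real.log r / 2) = r * Real.exp (-(1 / 2) * Real.log r) := by
      conv_rhs => rw [← Real.exp_log hr0, Real.log_exp, ← Real.exp_add]
      ring_nf
    rw [h5] at h4
    have h6 : stateFun r x ≤ 2 * (x / r) * Real.exp (-(1 / 2) * Real.log r) := by
      refine h3.trans ?_
      rw [div_le_iff₀ hr0]
      linarith
    have h7 : c * x ≤ x * (2 * (Real.log r * Real.exp (-(1 / 2) * Real.log r))) := by
      refine hle.trans ((mul_le_mul_of_nonneg_right h6 (by positivity)).trans_eq ?_)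
      field_simp
    nlinarith
  · have hle' : x ≤ max β 1 * r * Real.log r := by
      have := mul_le_mul_of_nonneg_right (le_max_left β 1) (show 0 ≤ r * Real.log r by positivity)
      linarith
    have h3 := stateFun_monotoneOn hr (Set.mem_Ici.2 hx.le) (Set.mem_Ici.2 (hx.le.trans hle')) hle'
    have h4 : stateFun r x < c / 4 := lt_of_le_of_lt h3 h1
    have hR : 0 < r * Real.log r := by positivity
    nlinarith

/-- Beyond `3 r log r` the defect `1 - 𝓜_r` is so small that `x ↦ 𝓜_r(x) / x` is strictly
decreasing. -/
lemma eventually_stateFun_div_lt :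
    ∀ᶠ r : ℕ in atTop, ∀ x y : ℝ, 3 * (r * Real.log r) ≤ x → x < y →
      stateFun r y / y < stateFun r x / x := by
  have lim1 : Tendsto (fun q : ℝ => 16 * (q * Real.exp (-(1 / 72) * q))) atTop (𝓝 0) := by
    have h1 := tendsto_rpow_mul_exp_neg_mul_atTop_nhds_zero 1 (1 / 72) (by norm_num)
    simpa using h1.const_mul 16
  obtain ⟨Q, hQ⟩ := eventually_atTop.1
    (lim1.eventually_lt_const (show (0 : ℝ) < 1 / 2 by norm_num))
  filter_upwards [eventually_ge_atTop 2, tendsto_log_natCast.eventually_ge_atTop (max Q 1)]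
    with r hr hlog x y hx hxy
  have hr0 : (0 : ℝ) < r := by exact_mod_cast (by omega : 0 < r)
  have hlog1 : 1 ≤ Real.log r := (le_max_right Q 1).trans hlog
  have hq : 3 * Real.log r ≤ x / r := by
    rw [le_div_iff₀ hr0]; linarith
  have hx0 : 0 < x := lt_of_lt_of_le (by positivity) hx
  have hy0 : 0 < y := hx0.trans hxy
  have h1 := one_sub_stateFun_le hr hx0.le (θ := 1 / 6) (by norm_num) (by norm_num)
  have h2 : 1 - stateFun r x ≤ 4 * Real.exp (-(1 / 72) * (x / r)) := by
    refine h1.trans ?_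
    gcongr
    linarith
  have h3 := hQ (x / r) (by linarith [le_max_left Q 1])
  have h4 : 4 * (x / r) * (1 - stateFun r x) < 1 / 2 := by
    have := mul_le_mul_of_nonneg_left h2 (show 0 ≤ 4 * (x / r) by positivity)
    linarith
  have hM1 := stateFun_le_one hr x
  have h5 : 1 / 2 < stateFun r x := by nlinarith
  set h := (y - x) / r with hh
  have hh0 : 0 < h := div_pos (by linarith) hr0
  have h6 : stateFun r y - stateFun r x ≤ 4 * h * (1 - stateFun r x) := by
    rcases le_total h (1 / 4) with hs | hb
    · refine (stateFun_sub_le hr hx0.le hxy.le).trans ?_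
      refine mul_le_mul_of_nonneg_right ?_ (by linarith)
      have := Real.abs_exp_sub_one_le (x := 2 * h) (by rw [abs_of_pos (by linarith)]; linarith)
      rw [abs_of_pos (show 0 < 2 * h by linarith)] at this
      linarith [le_abs_self (Real.exp (2 * h) - 1)]
    · have := stateFun_le_one hr y
      nlinarith
  rw [div_lt_div_iff₀ hy0 hx0]
  have h7 : x * (4 * h * (1 - stateFun r x)) = (4 * (x / r) * (1 - stateFun r x)) * (y - x) := by
    rw [hh]; field_simp
  have h8 := mul_le_mul_of_nonneg_left h6 hx0.le
  have h9 : (4 * (x / r) * (1 - stateFun r x)) * (y - x) < stateFun r x * (y - x) :=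
    mul_lt_mul_of_pos_right (by linarith) (by linarith)
  nlinarith

end

section

variable {r : ℕ}

/-! ### The dynamic spinodal -/

/-- A fixed point `b > 0` at noise `Δ` amounts to `x = b / Δ > 0` with `Δ = 𝓜_r(x) / x`. -/
lemma mem_dynSet_iff {Δ : ℝ} :
    Δ ∈ dynSet r ↔ 0 < Δ ∧ ∃ x : ℝ, 0 < x ∧ stateFun r x / x = Δ := by
  refine and_congr_right fun hΔ => ⟨?_, ?_⟩
  · rintro ⟨b, hb, hfix⟩
    refine ⟨b / Δ, div_pos hb hΔ, ?_⟩
    rw [stateEvolution] at hfix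
    rw [hfix]
    field_simp
  · rintro ⟨x, hx, h⟩
    refine ⟨x * Δ, mul_pos hx hΔ, ?_⟩
    rw [stateEvolution, mul_div_cancel_right₀ _ hΔ.ne', ← h]
    field_simp

lemma eventually_mul_log_pos : ∀ᶠ r : ℕ in atTop, 0 < (r : ℝ) * Real.log r := by
  filter_upwards [eventually_ge_atTop 2, tendsto_log_natCast.eventually_gt_atTop 0] with r hr hlog
  have hr0 : (0 : ℝ) < r := by exact_mod_cast (by omega : 0 < r)
  positivity

lemma stateFun_div_continuousOn (hr : 2 ≤ r) {a b : ℝ} (ha : 0 < a) :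
    ContinuousOn (fun x => stateFun r x / x) (Set.Icc a b) :=
  ((stateFun_continuousOn hr).mono fun _ hx => ha.le.trans hx.1).div continuousOn_id
    fun _ hx => (ha.trans_le hx.1).ne'

lemma eventually_isGreatest_dynSet :
    ∀ᶠ r : ℕ in atTop, IsGreatest (dynSet r) (deltaDyn r) := by
  filter_upwards [eventually_ge_atTop 2, eventually_mul_log_pos,
    (tendsto_stateFun_of_two_lt (β := 3) (by norm_num)).eventually_const_lt
      (show (3 / 4 : ℝ) < 1 by norm_num),
    eventually_le_of_le_stateFun (β := 1) (c := 1 / 4) (by norm_num) (by norm_num)]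
    with r hr hR h3 hno
  set R := (r : ℝ) * Real.log r with hRdef
  rw [mul_assoc, ← hRdef] at h3
  obtain ⟨xm, hxm, hmax⟩ := (isCompact_Icc (a := R) (b := 4 * R)).exists_isMaxOn
    (Set.nonempty_Icc.2 (by linarith)) (stateFun_div_continuousOn hr hR)
  have hlow : 1 / (4 * R) < stateFun r xm / xm := by
    refine lt_of_lt_of_le ?_ (hmax (show 3 * R ∈ Set.Icc R (4 * R) from
      ⟨by linarith, by linarith⟩))
    rw [div_lt_div_iff₀ (by positivity) (by positivity)]
    nlinarith
  have hG : IsGreatest (dynSet r) (stateFun r xm / xm) := by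
    refine ⟨mem_dynSet_iff.2 ⟨lt_trans (by positivity) hlow, xm, hR.trans_le hxm.1, rfl⟩, ?_⟩
    intro Δ hΔ
    obtain ⟨hΔ0, x, hx, rfl⟩ := mem_dynSet_iff.1 hΔ
    rcases le_total (stateFun r x / x) (1 / (4 * R)) with h | h
    · exact h.trans hlow.le
    · have h1 : 1 / 4 * x / R ≤ stateFun r x := by
        rw [le_div_iff₀ hx] at h
        exact le_trans (le_of_eq (by field_simp)) h
      have h2 := hno x hx h1
      have h3 := stateFun_le_one hr x
      refine hmax (show x ∈ Set.Icc R (4 * R) from ⟨by linarith, ?_⟩)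
      rw [div_le_iff₀ hR] at h1
      nlinarith
  have : deltaDyn r = stateFun r xm / xm := hG.csSup_eq
  rwa [this]

lemma tendsto_deltaDyn :
    Tendsto (fun r : ℕ => deltaDyn r * (2 * r * Real.log r)) atTop (𝓝 1) := by
  refine tendsto_order.2 ⟨fun a ha => ?_, fun a ha => ?_⟩
  · obtain ⟨β, hβ1, hβ2⟩ : ∃ β : ℝ, 2 < β ∧ a * β < 2 := by
      refine ⟨2 + (1 - max a 0), ?_, ?_⟩
      · have : max a 0 < 1 := max_lt ha one_pos
        linarith
      · rcases le_total a 0 with h | h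
        · rw [max_eq_right h]; nlinarith
        · rw [max_eq_left h]; nlinarith
    have h1 := (tendsto_stateFun_of_two_lt hβ1).eventually_const_lt
      (show max (a * β / 2) 0 < 1 from max_lt (by linarith) one_pos)
    filter_upwards [h1, eventually_isGreatest_dynSet, eventually_mul_log_pos] with r h1 hG hR
    set R := (r : ℝ) * Real.log r with hRdef
    rw [mul_assoc, ← hRdef] at h1
    have hx : 0 < β * R := by positivity
    have hM : 0 < stateFun r (β * R) := (le_max_right _ _).trans_lt h1
    have hle := hG.2 (mem_dynSet_iff.2 ⟨div_pos hM hx, β * R, hx, rfl⟩)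
    have h2 := (le_max_left _ _).trans_lt h1
    calc a < stateFun r (β * R) / (β * R) * (2 * R) := by
          rw [div_mul_eq_mul_div, lt_div_iff₀ hx]
          nlinarith
      _ ≤ deltaDyn r * (2 * R) := by gcongr
      _ = _ := by rw [hRdef]; ring
  · obtain ⟨β, hβ0, hβ1, hβ2⟩ : ∃ β : ℝ, 0 < β ∧ β < 2 ∧ 2 < a * β := by
      refine ⟨1 + 1 / a, by positivity, ?_, ?_⟩
      · have : 1 / a < 1 := (div_lt_one (by linarith)).2 ha
        linarith
      · rw [mul_add, mul_one_div_cancel (by linarith)]; linarith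
    filter_upwards [eventually_ge_atTop 2, eventually_isGreatest_dynSet, eventually_mul_log_pos,
      eventually_le_of_le_stateFun (c := a / 2) hβ1 (by linarith)] with r hr hG hR hno
    set R := (r : ℝ) * Real.log r with hRdef
    obtain ⟨hΔ0, x, hx, hxe⟩ := mem_dynSet_iff.1 hG.1
    by_contra! hge
    have hge : a ≤ deltaDyn r * (2 * R) := hge.trans_eq (by rw [hRdef]; ring)
    rw [← hxe, div_mul_eq_mul_div, le_div_iff₀ hx] at hge
    have h1 : a / 2 * x / R ≤ stateFun r x := by
      rw [div_le_iff₀ hR]; linarith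
    have h2 := hno x hx h1
    have h3 := stateFun_le_one hr x
    nlinarith

/-! ### The information-theoretic transition -/

/-- The difference `φ(b) - φ(0)` of free energies at noise `Δ = b / x`, as a function of `x` and
`b`. -/
def gap (r : ℕ) (b x : ℝ) : ℝ :=
  x / r / 2 - Real.log r + logLoss (r - 1) (x / r) - x / (2 * r ^ 2) -
    b * x * (r - 1) / (4 * r ^ 2)

lemma logLoss_zero (n : ℕ) : logLoss n 0 = Real.log ((n : ℝ) + 1) := by
  simp [logLoss, ratioSum, weight, add_comm]

lemma freeEnergy_sub_freeEnergy_zero (hr : 2 ≤ r) {Δ b : ℝ} (hΔ : 0 < Δ) (hb0 : 0 ≤ b)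
    (hb1 : b ≤ 1) : freeEnergy r Δ b - freeEnergy r Δ 0 = gap r b (b / Δ) := by
  obtain ⟨n, rfl⟩ : ∃ n, r = n + 1 := ⟨r - 1, by omega⟩
  rw [freeEnergy_succ n hΔ hb0 hb1, freeEnergy_succ n hΔ le_rfl zero_le_one, gap,
    Nat.add_sub_cancel, zero_div, zero_div, logLoss_zero]
  push_cast
  field_simp
  ring

/-- The relative error in the leading-order asymptotics of the free energy. -/
def gapError (r : ℕ) : ℝ := (2 + 4 * √(5 * Real.log r)) / Real.log r + 5 / r

lemma tendsto_gapError : Tendsto gapError atTop (𝓝 0) := by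
  have h1 : Tendsto (fun r : ℕ => √5 * (4 / √(Real.log r))) atTop (𝓝 0) := by
    have := (Real.tendsto_sqrt_atTop.comp tendsto_log_natCast).const_div_atTop 4
    simpa using this.const_mul (√5)
  have h2 : Tendsto (fun r : ℕ => 2 / Real.log r) atTop (𝓝 0) :=
    tendsto_log_natCast.const_div_atTop 2
  have h3 : Tendsto (fun r : ℕ => (5 : ℝ) / r) atTop (𝓝 0) :=
    tendsto_natCast_atTop_atTop.const_div_atTop 5
  have h4 := (h2.add h1).add h3
  simp only [add_zero] at h4
  refine h4.congr' ?_
  filter_upwards [tendsto_log_natCast.eventually_gt_atTop 0] with r hr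
  have hs : 0 < √(Real.log r) := Real.sqrt_pos.2 hr
  rw [gapError, Real.sqrt_mul (by norm_num), add_div]
  congr 2
  rw [mul_div_assoc', div_eq_div_iff hs.ne' hr.ne']
  linear_combination (-(4 * √5)) * Real.mul_self_sqrt hr.le

/-- With `x = y r log r`, the free energy gap is `log r` times `(y / 2 - 1)⁺ - b y / 4`, up to
`gapError`. -/
lemma gap_bounds (hr : 2 ≤ r) {b x : ℝ} (hb0 : 0 ≤ b) (hb1 : b ≤ 1) {y : ℝ} (hy0 : 0 ≤ y)
    (hy5 : y ≤ 5) (hx : x = y * (r * Real.log r)) :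
    gap r b x ≤ Real.log r * (max (y / 2 - 1) 0 - b * y / 4 + gapError r) ∧
    Real.log r * (y / 2 - 1 - b * y / 4 - gapError r) ≤ gap r b x := by
  have hr0 : (0 : ℝ) < r := by exact_mod_cast (by omega : 0 < r)
  have hr1 : (1 : ℝ) < r := by exact_mod_cast (by omega : 1 < r)
  set L := Real.log r with hL
  have hL0 : 0 < L := Real.log_pos hr1
  have hq : x / r = y * L := by rw [hx]; field_simp
  have e1 : gap r b x = y * L / 2 - L + logLoss (r - 1) (y * L) - y * L / (2 * r) -
      b * y * L / 4 + b * y * L / (4 * r) := by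
    rw [gap, hq, hx]
    field_simp
    ring
  have eE : L * gapError r = (2 + 4 * √(5 * L)) + 5 * L / r := by
    rw [gapError, ← hL]
    field_simp
  have hK0 : 0 ≤ logLoss (r - 1) (y * L) := integral_nonneg fun w =>
    Real.log_nonneg (by have := ratioSum_nonneg (y * L) w; linarith)
  have hK1 := logLoss_le (n := r - 1) (by omega) (show 0 ≤ y * L by positivity)
  have hlog : Real.log ((r - 1 : ℕ) : ℝ) ≤ L :=
    Real.log_le_log (by exact_mod_cast (show 0 < r - 1 by omega)) (by exact_mod_cast Nat.sub_le r 1)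
  have hmax : max (Real.log ((r - 1 : ℕ) : ℝ) - y * L / 2) 0 ≤
      L * max (y / 2 - 1) 0 - (y * L / 2 - L) := by
    rw [mul_max_of_nonneg _ _ hL0.le, mul_zero]
    apply max_le
    · linarith [le_max_right (L * (y / 2 - 1)) 0]
    · linarith [le_max_left (L * (y / 2 - 1)) 0]
  have hsq : √(y * L) ≤ √(5 * L) := Real.sqrt_le_sqrt (by gcongr)
  have hby : b * y ≤ 5 := by nlinarith
  have hf1 : b * y * L / (4 * r) ≤ 5 * L / r := by
    rw [div_le_div_iff₀ (by positivity) hr0]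
    have := mul_le_mul_of_nonneg_right hby (show 0 ≤ L * r by positivity)
    have : 0 < L * r := by positivity
    nlinarith
  have hf2 : y * L / (2 * r) ≤ 5 * L / r := by
    rw [div_le_div_iff₀ (by positivity) hr0]
    have := mul_le_mul_of_nonneg_right hy5 (show 0 ≤ L * r by positivity)
    have : 0 < L * r := by positivity
    nlinarith
  have hf3 : 0 ≤ b * y * L / (4 * r) := by positivity
  have hf4 : 0 ≤ y * L / (2 * r) := by positivity
  have hs0 := Real.sqrt_nonneg (5 * L)
  constructor
  · rw [e1, mul_add, eE]; linarith
  · rw [e1, mul_sub, eE]; linarith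

lemma gap_continuousOn (hr : 2 ≤ r) :
    ContinuousOn (fun x => gap r (stateFun r x) x) (Set.Ici 0) := by
  have h1 : ContinuousOn (fun x : ℝ => logLoss (r - 1) (x / r)) (Set.Ici 0) :=
    (continuousOn_logLoss (r - 1)).comp (by fun_prop) fun x hx =>
      div_nonneg (Set.mem_Ici.1 hx) (Nat.cast_nonneg r)
  have h2 := stateFun_continuousOn hr
  unfold gap
  fun_prop

/-- Beyond `3 r log r`, where `x ↦ 𝓜_r(x) / x` is strictly decreasing, each `x` encodes the
informative fixed point at noise `𝓜_r(x) / x`. -/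
lemma isInformative_of_div_lt (hr : 2 ≤ r) {x : ℝ} (hx : 0 < x) (hM : 0 < stateFun r x)
    (hlt : ∀ y, x < y → stateFun r y / y < stateFun r x / x) :
    IsInformative r (stateFun r x / x) (stateFun r x) := by
  have hΔ : 0 < stateFun r x / x := div_pos hM hx
  set Δ := stateFun r x / x with hΔdef
  have hxΔ : stateFun r x / Δ = x := by rw [hΔdef]; field_simp
  obtain ⟨b, hb0, hb1, hinf, hfix, hmax⟩ := exists_isInformative hr hΔ
  have hle : stateFun r x ≤ b := hmax _ hM.le (by rw [stateEvolution, hxΔ])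
  rcases hle.eq_or_lt with h | h
  · rwa [h]
  · exfalso
    have h1 := hlt (b / Δ) (by rw [← hxΔ]; gcongr)
    rw [stateEvolution] at hfix
    rw [hfix] at h1
    have : b / (b / Δ) = Δ := by
      have : b ≠ 0 := by linarith
      field_simp
    linarith

/-- For noise above the spectral threshold, an element of `itSet` is given by a positive solution
of `Δ = 𝓜_r(x) / x` at which the free energy gap vanishes. -/
lemma exists_of_mem_itSet (hr : 2 ≤ r) {Δ : ℝ} (hΔ : Δ ∈ itSet r) (hc : 1 / (r : ℝ) ^ 2 < Δ) :
    ∃ x : ℝ, 0 < x ∧ stateFun r x = Δ * x ∧ gap r (stateFun r x) x = 0 := by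
  obtain ⟨hΔ0, b₀, b₁, hun, hinf, hne, hfe⟩ := hΔ
  obtain ⟨ε, h1, h2⟩ := (hun.and (isUninformative_zero hr hc)).exists
  obtain rfl := tendsto_nhds_unique h1 h2
  obtain ⟨b, hb0, hb1, hinf', hfix, -⟩ := exists_isInformative hr hΔ0
  obtain rfl := tendsto_nhds_unique hinf hinf'
  rw [stateEvolution] at hfix
  refine ⟨b₁ / Δ, div_pos (lt_of_le_of_ne hb0 hne) hΔ0, ?_, ?_⟩
  · rw [hfix]; field_simp
  · rw [hfix, ← freeEnergy_sub_freeEnergy_zero hr hΔ0 hb0 hb1]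
    linarith

/-- A partial converse of `exists_of_mem_itSet`. -/
lemma mem_itSet_of_gap_eq_zero (hr : 2 ≤ r) {x : ℝ} (hx : 0 < x) (hM : 0 < stateFun r x)
    (hlt : ∀ y, x < y → stateFun r y / y < stateFun r x / x)
    (hc : 1 / (r : ℝ) ^ 2 < stateFun r x / x) (hgap : gap r (stateFun r x) x = 0) :
    stateFun r x / x ∈ itSet r := by
  have hΔ : 0 < stateFun r x / x := div_pos hM hx
  refine ⟨hΔ, 0, stateFun r x, isUninformative_zero hr hc, isInformative_of_div_lt hr hx hM hlt,
    hM.ne, ?_⟩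
  have h1 := freeEnergy_sub_freeEnergy_zero hr hΔ hM.le (stateFun_le_one hr x)
  have h2 : stateFun r x / (stateFun r x / x) = x := by field_simp
  rw [h2, hgap] at h1
  linarith

/-- Below `3 r log r`, a fixed point at noise at least `15 / (64 r log r)` has smaller free energy
than the uniform one. -/
lemma gap_neg (hr : 2 ≤ r) (he : gapError r < 1 / 100) {b y : ℝ} (hb1 : b ≤ 1) (hy1 : 1 ≤ y)
    (hy3 : y ≤ 3) (hby : 15 / 64 * y ≤ b) : gap r b (y * (r * Real.log r)) < 0 := by
  have hL0 : 0 < Real.log r := Real.log_pos (by exact_mod_cast (by omega : 1 < r))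
  have g1 := (gap_bounds hr (by linarith : 0 ≤ b) hb1 (by linarith : 0 ≤ y) (by linarith) rfl).1
  refine g1.trans_lt (mul_neg_of_pos_of_neg hL0 ?_)
  have hby2 : 15 / 64 * y * y ≤ b * y := mul_le_mul_of_nonneg_right hby (by linarith)
  rcases le_total (y / 2 - 1) 0 with h | h
  · rw [max_eq_right h]
    linarith [sq_nonneg (y - 1)]
  · rw [max_eq_left h]
    linarith [sq_nonneg (y - 3)]

/-- A zero `x = y r log r` of the free energy gap with `b ≈ 1` has `y ≈ 4`. -/
lemma abs_sub_one_le_of_gap_eq_zero (hr : 2 ≤ r) {η : ℝ} (hη0 : 0 < η) (hη1 : η ≤ 1 / 100)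
    (he : gapError r < η) {b y : ℝ} (hb : 1 - η ≤ b) (hb1 : b ≤ 1) (hy3 : 3 ≤ y) (hy5 : y ≤ 5)
    (h0 : gap r b (y * (r * Real.log r)) = 0) :
    1 - 2 * η ≤ 4 * b / y ∧ |4 * b / y - 1| ≤ 4 * η := by
  have hL0 : 0 < Real.log r := Real.log_pos (by exact_mod_cast (by omega : 1 < r))
  obtain ⟨g1, g2⟩ := gap_bounds hr (by linarith : 0 ≤ b) hb1 (by linarith : 0 ≤ y) hy5 rfl
  rw [h0] at g1 g2
  rw [max_eq_left (by linarith)] at g1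
  have g1' := nonneg_of_mul_nonneg_right g1 hL0
  have g2' := nonpos_of_mul_nonpos_right g2 hL0
  have hy0 : 0 ≤ y := by linarith
  have hyhi : y ≤ 4 * (1 + η) := by linarith [mul_le_mul_of_nonneg_right hb1 hy0]
  have hylo : 4 * (1 - η) ≤ y * (1 + η) := by linarith [mul_le_mul_of_nonneg_right hb hy0]
  have hlo : 1 - 2 * η ≤ 4 * b / y := by
    rw [le_div_iff₀ (by linarith)]
    have := mul_le_mul_of_nonneg_left hyhi (show 0 ≤ 1 - 2 * η by linarith)
    nlinarith
  have hhi : 4 * b / y ≤ 1 + 4 * η := by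
    rw [div_le_iff₀ (by linarith)]
    nlinarith [mul_nonneg hη0.le (by linarith : 0 ≤ y - 3)]
  refine ⟨hlo, ?_⟩
  rw [abs_le]
  constructor <;> linarith

/-- The maximum is taken over the zeros of the free energy gap in `3 r log r ≤ x ≤ 5 r log r`. There
`b ≈ 1`, so that at leading order the gap vanishes when `y / 2 - 1 = y / 4`, that is `y = 4`. -/
lemma eventually_isGreatest_itSet_and {ε : ℝ} (hε : 0 < ε) :
    ∀ᶠ r : ℕ in atTop, IsGreatest (itSet r) (deltaIT r) ∧
      |deltaIT r * (4 * r * Real.log r) - 1| ≤ ε := by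
  set η := min (ε / 4) (1 / 100) with hη
  have hη0 : 0 < η := lt_min (by linarith) (by norm_num)
  have hη1 : η ≤ 1 / 100 := min_le_right _ _
  have hηε : 4 * η ≤ ε := by have := min_le_left (ε / 4) (1 / 100 : ℝ); linarith
  have hspec : ∀ᶠ r : ℕ in atTop, 10 * Real.log r < r := by
    have := (Real.isLittleO_log_id_atTop.comp_tendsto tendsto_natCast_atTop_atTop).def
      (show (0 : ℝ) < 1 / 20 by norm_num)
    filter_upwards [this, eventually_gt_atTop 0] with r h1 h2
    have h2' : (0 : ℝ) < r := by exact_mod_cast h2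
    simp only [Function.comp_apply, id, Real.norm_eq_abs, abs_of_pos h2'] at h1
    linarith [le_abs_self (Real.log r)]
  filter_upwards [eventually_ge_atTop 2, eventually_mul_log_pos, hspec,
    tendsto_gapError.eventually_lt_const hη0,
    (tendsto_stateFun_of_two_lt (β := 3) (by norm_num)).eventually_const_lt
      (show 1 - η < 1 by linarith),
    eventually_le_of_le_stateFun (β := 1) (c := 15 / 64) (by norm_num) (by norm_num),
    eventually_stateFun_div_lt] with r hr hR hspec he h3 hno hdec
  have hr0 : (0 : ℝ) < r := by exact_mod_cast (by omega : 0 < r)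
  have hL0 : 0 < Real.log r := by
    by_contra! h; nlinarith
  set R := (r : ℝ) * Real.log r with hRdef
  rw [mul_assoc, ← hRdef] at h3
  have hRr : 1 / (r : ℝ) ^ 2 < 1 / (10 * R) := by
    rw [div_lt_div_iff₀ (by positivity) (by positivity), hRdef]
    nlinarith
  have hM1 : ∀ x, stateFun r x ≤ 1 := stateFun_le_one hr
  have hMη : ∀ x, 3 * R ≤ x → 1 - η ≤ stateFun r x := fun x hx => h3.le.trans
    (stateFun_monotoneOn hr (Set.mem_Ici.2 (by positivity))
      (Set.mem_Ici.2 (le_trans (by positivity) hx)) hx)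
  have hM0 : ∀ x, 3 * R ≤ x → 0 < stateFun r x := fun x hx => by
    have := hMη x hx; linarith
  have hcont : ContinuousOn (fun x => gap r (stateFun r x) x) (Set.Icc (3 * R) (5 * R)) :=
    (gap_continuousOn hr).mono fun x hx => le_trans (by positivity) hx.1
  -- the gap changes sign between `3 r log r` and `5 r log r`
  have hneg : gap r (stateFun r (3 * R)) (3 * R) ≤ 0 := by
    have h1 := (gap_bounds hr (hM0 _ le_rfl).le (hM1 _) (y := 3) (by norm_num) (by norm_num)
      rfl).1
    refine h1.trans (mul_nonpos_of_nonneg_of_nonpos hL0.le ?_)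
    rw [max_eq_left (by norm_num)]
    linarith
  have hpos : 0 ≤ gap r (stateFun r (5 * R)) (5 * R) := by
    have h1 := (gap_bounds hr (hM0 (5 * R) (by linarith)).le (hM1 _) (y := 5) (by norm_num) le_rfl
      rfl).2
    refine le_trans (mul_nonneg hL0.le ?_) h1
    have := hM1 (5 * R)
    linarith
  set X := Set.Icc (3 * R) (5 * R) ∩ {x | gap r (stateFun r x) x = 0} with hX
  have hXne : X.Nonempty := by
    obtain ⟨x, hx, hx0⟩ := intermediate_value_Icc (show 3 * R ≤ 5 * R by linarith) hcont
      ⟨hneg, hpos⟩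
    exact ⟨x, hx, hx0⟩
  have hXc : IsCompact X :=
    isCompact_Icc.of_isClosed_subset
      (hcont.preimage_isClosed_of_isClosed isClosed_Icc isClosed_singleton) Set.inter_subset_left
  have hδc : ContinuousOn (fun x => stateFun r x / x) X :=
    (stateFun_div_continuousOn hr (by positivity)).mono Set.inter_subset_left
  obtain ⟨xm, hxm, hmax⟩ := hXc.exists_isMaxOn hXne hδc
  -- on `X` the noise is close to `1 / (4 r log r)`
  have hX4 : ∀ x ∈ X, |stateFun r x / x * (4 * R) - 1| ≤ 4 * η ∧
      15 / 64 / R < stateFun r x / x := by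
    rintro x ⟨⟨hx3, hx5⟩, hx0⟩
    have hxpos : 0 < x := lt_of_lt_of_le (by positivity) hx3
    set y := x / R with hy
    have hy3 : 3 ≤ y := by rw [hy, le_div_iff₀ hR]; exact hx3
    have hy5 : y ≤ 5 := by rw [hy, div_le_iff₀ hR]; exact hx5
    have hxy : x = y * R := by rw [hy]; field_simp
    have e : stateFun r x / x * (4 * R) = 4 * stateFun r x / y := by
      rw [hy]; field_simp
    have hgap : gap r (stateFun r x) x = 0 := hx0
    rw [hxy] at hgap
    nth_rw 1 [← hxy] at hgap
    obtain ⟨hlo, habs⟩ := abs_sub_one_le_of_gap_eq_zero hr hη0 hη1 he (hMη x hx3) (hM1 x) hy3 hy5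
      hgap
    rw [← e] at hlo habs
    refine ⟨habs, ?_⟩
    rw [div_lt_iff₀ hR]
    linarith
  have hG : IsGreatest (itSet r) (stateFun r xm / xm) := by
    have hxm3 : 3 * R ≤ xm := hxm.1.1
    have hxm0 : 0 < xm := lt_of_lt_of_le (by positivity) hxm3
    have h4 := (hX4 xm hxm).2
    refine ⟨mem_itSet_of_gap_eq_zero hr hxm0 (hM0 xm hxm3) (fun y hy => hdec xm y hxm3 hy) ?_
      hxm.2, fun Δ hΔ => ?_⟩
    · refine (hRr.trans ?_).trans h4
      rw [div_lt_div_iff₀ (by positivity) hR]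
      linarith
    · by_contra! hlt
      have hΔlow : 15 / 64 / R < Δ := h4.trans hlt
      have hΔc : 1 / (r : ℝ) ^ 2 < Δ := by
        refine (hRr.trans ?_).trans hΔlow
        rw [div_lt_div_iff₀ (by positivity) hR]
        linarith
      obtain ⟨x, hx, hfix, hgap⟩ := exists_of_mem_itSet hr hΔ hΔc
      have hΔ0 := hΔ.1
      have hb1 := hM1 x
      have hxR := hno x hx (by
        rw [hfix, div_le_iff₀ hR]
        rw [div_lt_iff₀ hR] at hΔlow
        nlinarith)
      rw [one_mul] at hxR
      rw [div_lt_iff₀ hR] at hΔlow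
      set y := x / R with hy
      have hxy : x = y * R := by rw [hy]; field_simp
      have hy1 : 1 ≤ y := by rw [hy, le_div_iff₀ hR]; linarith
      have hby : 15 / 64 * y ≤ stateFun r x := by
        rw [hfix, hxy]; nlinarith
      have hy5 : y ≤ 5 := by linarith
      rcases le_total (3 * R) x with hx3 | hx3
      · -- then `x` lies in `X`, over which `xm` is maximal
        have hxX : x ∈ X := ⟨⟨hx3, by rw [hxy]; gcongr⟩, hgap⟩
        have h5 : stateFun r x / x ≤ stateFun r xm / xm := hmax hxX
        rw [hfix, mul_div_cancel_right₀ _ hx.ne'] at h5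
        linarith
      · -- below `3 r log r` the gap is negative
        have hy3 : y ≤ 3 := by rw [hy, div_le_iff₀ hR]; exact hx3
        have h5 := gap_neg hr (he.trans_le hη1) hb1 hy1 hy3 hby
        rw [← hRdef, ← hxy, hgap] at h5
        exact lt_irrefl _ h5
  have hsup : deltaIT r = stateFun r xm / xm := hG.csSup_eq
  rw [hsup]
  refine ⟨hG, ?_⟩
  rw [mul_assoc, ← hRdef]
  exact (hX4 xm hxm).1.trans hηε

lemma isEquivalent_of_tendsto_mul {u : ℕ → ℝ} {c : ℝ} (hc : 0 < c)
    (h : Tendsto (fun r : ℕ => u r * (c * r * Real.log r)) atTop (𝓝 1)) :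
    u ~[atTop] fun r : ℕ => 1 / (c * (r : ℝ) * Real.log r) := by
  refine (isEquivalent_iff_tendsto_one ?_).2 (h.congr fun r => ?_)
  · filter_upwards [eventually_mul_log_pos] with r hr
    rw [mul_assoc]
    positivity
  · rw [Pi.div_apply, div_div_eq_mul_div, div_one]

end

end CommunityDetection

end

theorem mainTheorem6 :
    -- the limit of the state evolution function, `𝓜_r(β r log r) → 1(β > 2)`
    (∀ β : ℝ, 0 ≤ β → β ≠ 2 →
      Tendsto (fun r : ℕ => CommunityDetection.stateFun r (β * r * Real.log r)) atTop
        (𝓝 (if 2 < β then 1 else 0))) ∧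
    -- the dynamic spinodal is attained for large `r`, and `Δ_Dyn ~ 1 / (2 r log r)`
    (∀ᶠ r : ℕ in atTop,
      IsGreatest (CommunityDetection.dynSet r) (CommunityDetection.deltaDyn r)) ∧
    (CommunityDetection.deltaDyn ~[atTop] fun r : ℕ => 1 / (2 * (r : ℝ) * Real.log r)) ∧
    -- the information theoretic transition is attained for large `r`, `Δ_IT ~ 1 / (4 r log r)`
    (∀ᶠ r : ℕ in atTop,
      IsGreatest (CommunityDetection.itSet r) (CommunityDetection.deltaIT r)) ∧
    (CommunityDetection.deltaIT ~[atTop] fun r : ℕ => 1 / (4 * (r : ℝ) * Real.log r)) ∧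
    -- the spectral transition
    (∀ r : ℕ, 2 ≤ r → CommunityDetection.deltaC r = 1 / (r : ℝ) ^ 2) := by
  refine ⟨fun β hβ0 hβ2 => ?_, CommunityDetection.eventually_isGreatest_dynSet,
    CommunityDetection.isEquivalent_of_tendsto_mul two_pos CommunityDetection.tendsto_deltaDyn,
    ?_, CommunityDetection.isEquivalent_of_tendsto_mul four_pos ?_,
    fun r hr => CommunityDetection.deltaC_eq hr⟩
  · split_ifs with h
    · exact CommunityDetection.tendsto_stateFun_of_two_lt h
    · exact CommunityDetection.tendsto_stateFun_of_lt_two hβ0 (lt_of_le_of_ne (not_lt.1 h) hβ2)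
  · filter_upwards [CommunityDetection.eventually_isGreatest_itSet_and one_pos] with r hr
    exact hr.1
  · rw [Metric.tendsto_nhds]
    intro ε hε
    filter_upwards [CommunityDetection.eventually_isGreatest_itSet_and (half_pos hε)] with r hr
    rw [Real.dist_eq]
    linarith [hr.2]
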